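/- Consider the following repeated zero-sum game with parameter $p\in[\tfrac12,1]$. The system is in one of two states $\underline s,\bar s$. The initial state is $\underline s$ with probability $\theta_0\in[0,1]$ (known to both players); after each stage the state is kept with probability $p$ and switched with probability $1-p$. At each stage Player 1, who knows the current and all past states and all past moves, plays $T$ or $B$, and simultaneously Player 2, who knows only the past moves of both players, plays $L$ or $R$. Player 1 gains $1$ if the state is $\underline s$ and $(T,L)$ is played, or if the state is $\bar s$ and $(B,R)$ is played; otherwise he gains $0$. A (mixed) strategy of a player assigns to each possible information of that player a probability distribution on his two moves. For strategies $\sigma,\tau$ of Players 1 and 2 let $\gamma_n(\sigma,\tau)$ be the expected average gain of Player 1 over the first $n$ stages. A strategy $\sigma$ guarantees $v$ if $\liminf_n\gamma_n(\sigma,\tau)\ge v$ for all $\tau$; a strategy $\tau$ guarantees $v$ if $\limsup_n\gamma_n(\sigma,\tau)\le v$ for all $\sigma$. The number $v$ is the value of the game if each player has a strategy that guarantees $v$, and a strategy of Player 1 is optimal if it guarantees the value. The strategy $\sigma^*$ of Hörner, Rosenberg, Solan and Vieille is the following. Player 1 maintains a number $\theta\in[0,1]$, initially $\theta=\theta_0$.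 If $\theta\le\frac12$, he plays $T$ with probability $1$ in state $\underline s$ and with probability $\frac{1-2\theta}{1-\theta}$ in state $\bar s$; if $\theta\ge\frac12$, he plays $T$ with probability $\frac{1-\theta}{\theta}$ in state $\underline s$ and with probability $0$ in state $\bar s$. After he has played $T$ or $B$, $\theta$ is replaced by $f_T(\theta)$ or $f_B(\theta)$ respectively, where $$f_T(\theta)=\begin{cases}p&\theta\ge\frac12\\ p\frac{\theta}{1-\theta}+(1-p)\frac{1-2\theta}{1-\theta}&\theta\le\frac12\end{cases}\qquad f_B(\theta)=\begin{cases}p\frac{2\theta-1}{\theta}+(1-p)\frac{1-\theta}{\theta}&\theta\ge\frac12\\ 1-p&\theta\le\frac12.\end{cases}$$ Then: 1. For every $p$ with $\frac12\le p<0.719$ and every $\theta_0\in[0,1]$, the game has a value and $\sigma^*$ is optimal for Player 1. 2. For $p=0.73275300915<0.733$ and every $\theta_0\in[0,1]$, $\sigma^*$ is not optimal; indeed, some strategy $\sigma$ of Player 1 guarantees a number $v$ that $\sigma^*$ does not guarantee. 3. Let $p_c$ be the supremum of all $q\in[\frac12,1]$ such that $\sigma^*$ is optimal for all $p\in[\frac12,q]$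 and all $\theta_0\in[0,1]$. Then $0.719<p_c<0.733$. -/

import Mathlib

open Filter

namespace RenaultGame

/-- The state of the system: `low` is `s̲` and `high` is `s̄`. -/
inductive State
  | low
  | high
  deriving DecidableEq

instance : Fintype State where
  elems := {State.low, State.high}
  complete := by intro x; cases x <;> simp

/-- Moves of Player 1: top, bottom. -/
inductive Move1
  | T
  | B
  deriving DecidableEq

instance : Fintype Move1 where
  elems := {Move1.T, Move1.B}
  complete := by intro x; cases x <;> simp

/-- Moves of Player 2: left, right. -/
inductive Move2
  | L
  | R
  deriving DecidableEq

instance : Fintype Move2 where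
  elems := {Move2.L, Move2.R}
  complete := by intro x; cases x <;> simp

/-- Everything that happens in one stage: the state and the two moves. -/
abbrev Stage := State × Move1 × Move2

/-- The gain of Player 1 in one stage: the matrix is `(1 0; 0 0)` in state `low` and
`(0 0; 0 1)` in state `high`. -/
def gain : Stage → ℝ
  | (State.low, Move1.T, Move2.L) => 1
  | (State.high, Move1.B, Move2.R) => 1
  | _ => 0

/-- A (behavioural, mixed) strategy of Player 1: the probability of playing `T`, given the past
(all past states and moves, most recent stage first) and the current state. -/
abbrev Strategy1 := List Stage → State → unitInterval

/-- A (behavioural, mixed) strategy of Player 2: the probability of playing `L`, given the past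
moves of both players, most recent first. Player 2 sees neither the states nor the gains. -/
abbrev Strategy2 := List (Move1 × Move2) → unitInterval

/-- Probability of a move of Player 1 who plays `T` with probability `q`. -/
def moveProb1 (q : ℝ) : Move1 → ℝ
  | Move1.T => q
  | Move1.B => 1 - q

/-- Probability of a move of Player 2 who plays `L` with probability `q`. -/
def moveProb2 (q : ℝ) : Move2 → ℝ
  | Move2.L => q
  | Move2.R => 1 - q

/-- Conditional probability that the current state is `s` given the past: the first state is `low`
with probability `θ₀`; afterwards the state is kept with probability `p` and switched with
probability `1 - p`. -/
def stateProb (p θ₀ : ℝ) : List Stage → State → ℝ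
  | [], State.low => θ₀
  | [], State.high => 1 - θ₀
  | (s', _, _) :: _, s => if s = s' then p else 1 - p

/-- Probability that the first stages of the play are exactly those in the list
(most recent stage first). -/
noncomputable def playProb (p θ₀ : ℝ) (σ : Strategy1) (τ : Strategy2) : List Stage → ℝ
  | [] => 1
  | (s, a, b) :: h =>
      playProb p θ₀ σ τ h * stateProb p θ₀ h s * moveProb1 (σ h s) a *
        moveProb2 (τ (h.map Prod.snd)) b

/-- Expected average gain of Player 1 over the first `n` stages. -/
noncomputable def avgGain (p θ₀ : ℝ) (σ : Strategy1) (τ : Strategy2) (n : ℕ) : ℝ :=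
  (∑ h : List.Vector Stage n, playProb p θ₀ σ τ h.toList * (h.toList.map gain).sum) / n

/-- Against every strategy of Player 2, the long-term expected gain of Player 1 under `σ` is at
least `v`. -/
def Guarantees1 (p θ₀ : ℝ) (σ : Strategy1) (v : ℝ) : Prop :=
  ∀ τ : Strategy2, v ≤ liminf (avgGain p θ₀ σ τ) atTop

/-- Against every strategy of Player 1, the long-term expected gain of Player 1 is at most `v` if
Player 2 uses `τ`. -/
def Guarantees2 (p θ₀ : ℝ) (τ : Strategy2) (v : ℝ) : Prop :=
  ∀ σ : Strategy1, limsup (avgGain p θ₀ σ τ) atTop ≤ v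

/-- `v` is the value of the game: Player 1 has a strategy that guarantees at least `v`, and
Player 2 has a strategy that guarantees at most `v`. -/
def IsValue (p θ₀ v : ℝ) : Prop :=
  (∃ σ, Guarantees1 p θ₀ σ v) ∧ ∃ τ, Guarantees2 p θ₀ τ v

/-- `σ` is optimal for Player 1: it guarantees the value of the game. -/
def IsOptimal (p θ₀ : ℝ) (σ : Strategy1) : Prop :=
  ∃ v, IsValue p θ₀ v ∧ Guarantees1 p θ₀ σ v

/-- The update maps `f_T` and `f_B` of the internal state `θ` of Player 1. -/
noncomputable def updateReal (p θ : ℝ) : Move1 → ℝ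
  | Move1.T =>
      if 1 / 2 ≤ θ then p else p * (θ / (1 - θ)) + (1 - p) * ((1 - 2 * θ) / (1 - θ))
  | Move1.B =>
      if 1 / 2 ≤ θ then p * ((2 * θ - 1) / θ) + (1 - p) * ((1 - θ) / θ) else 1 - p

/-- The probability with which `σ*` plays `T`, as a function of `θ` and the state. -/
noncomputable def playTReal (θ : ℝ) : State → ℝ
  | State.low => if θ ≤ 1 / 2 then 1 else (1 - θ) / θ
  | State.high => if θ ≤ 1 / 2 then (1 - 2 * θ) / (1 - θ) else 0

theorem updateReal_mem (p θ : unitInterval) (a : Move1) :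
    updateReal p θ a ∈ unitInterval := by
  obtain ⟨p, hp0, hp1⟩ := p
  obtain ⟨θ, h0, h1⟩ := θ
  cases a <;> simp only [updateReal] <;> split_ifs with h
  · exact ⟨hp0, hp1⟩
  · push Not at h
    have hd : 0 < 1 - θ := by linarith
    have e : p * (θ / (1 - θ)) + (1 - p) * ((1 - 2 * θ) / (1 - θ))
        = (p * θ + (1 - p) * (1 - 2 * θ)) / (1 - θ) := by ring
    rw [e]
    refine ⟨div_nonneg ?_ hd.le, (div_le_one hd).2 ?_⟩ <;> nlinarith
  · have hd : 0 < θ := by linarith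
    have e : p * ((2 * θ - 1) / θ) + (1 - p) * ((1 - θ) / θ)
        = (p * (2 * θ - 1) + (1 - p) * (1 - θ)) / θ := by ring
    rw [e]
    refine ⟨div_nonneg ?_ hd.le, (div_le_one hd).2 ?_⟩ <;> nlinarith
  · exact ⟨by linarith, by linarith⟩

theorem playTReal_mem (θ : unitInterval) (s : State) : playTReal θ s ∈ unitInterval := by
  obtain ⟨θ, h0, h1⟩ := θ
  cases s <;> simp only [playTReal] <;> split_ifs with h
  · exact ⟨zero_le_one, le_rfl⟩
  · push Not at h
    have hd : 0 < θ := by linarith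
    exact ⟨div_nonneg (by linarith) hd.le, (div_le_one hd).2 (by linarith)⟩
  · have hd : 0 < 1 - θ := by linarith
    exact ⟨div_nonneg (by linarith) hd.le, (div_le_one hd).2 (by linarith)⟩
  · exact ⟨le_rfl, zero_le_one⟩

/-- The internal state `θ` of Player 1 after the given past. It starts at the initial probability
`θ₀` of state `low`, which is the initial belief of Player 2, and is then updated by `f_T` and
`f_B` according to the moves of Player 1. -/
noncomputable def belief (p θ₀ : unitInterval) : List Stage → unitInterval
  | [] => θ₀
  | (_, a, _) :: h => ⟨updateReal p (belief p θ₀ h) a, updateReal_mem p (belief p θ₀ h) a⟩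

/-- The strategy `σ*` of Player 1. -/
noncomputable def sigmaStar (p θ₀ : unitInterval) : Strategy1 :=
  fun h s => ⟨playTReal (belief p θ₀ h) s, playTReal_mem (belief p θ₀ h) s⟩

/-- `σ*` is optimal for the parameter `p`, for every initial distribution of the state. -/
def SigmaStarOptimal (p : unitInterval) : Prop :=
  ∀ θ₀ : unitInterval, IsOptimal p θ₀ (sigmaStar p θ₀)

/-- The critical parameter: the supremum of the `q ∈ [1/2, 1]` such that `σ*` is optimal for all
`p ∈ [1/2, q]`. -/
noncomputable def criticalParameter : ℝ :=
  sSup {q : ℝ | 1 / 2 ≤ q ∧ q ≤ 1 ∧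
    ∀ p : unitInterval, 1 / 2 ≤ (p : ℝ) → (p : ℝ) ≤ q → SigmaStarOptimal p}

end RenaultGame

namespace RenaultGame

/-! Let x = min(θ, 1 - θ) be the folded belief, F = `foldMap p`, and let ℓ(x) be the expected time
until σ* reveals the state, so that ℓ(x) = 1 + (1 - x) ℓ(F x). Under σ* the stage gain is x whatever
Player 2 does, and x is also the probability of a revealing move, after which the folded belief
restarts at 1 - p. Hence Player 1 earns on average one unit per revelation, and σ* secures exactly v
= 1 / ℓ(1 - p) (`totalGain_star`).

For p ≤ 0.7191, Player 2 can hold Player 1 to v. Player 2 counts the non-revealing moves since the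
last revelation and uses the tangent to ℓ at the orbit point F^k(1 - p) as a potential
(`guarantees2_of_certificate`). This works if ℓ, extended to [1 - p, p] by symmetry about 1/2, is
convex, and if every tangent satisfies w ≤ u ≤ 2w for its values u at 1 - p and w at p. Both
properties are proved together by induction on the iterates of the recursion
(`isConvexIter_and_isFlatIter`). Convexity reduces the slope condition to the tangent at 1 - p,
which six explicit steps of the orbit settle (`flat_at_start`). For p ≤ 2/3 the function ℓ is affine
and no induction is needed.

For p = 0.73275300915 the slope of ℓ is too large. Revealing slightly less at one orbit point x
costs η in the stage, but moves both possible next folded beliefs to the right, where ℓ is smaller;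
to first order this returns v (2p - 1)(K + K') η, with K and K' the rates of decrease of ℓ to the
right of 1 - p and F x. Exact integer arithmetic shows that the return exceeds the cost
(`exists_steep_revealTime`), and `exists_improvement` turns this into a strategy that guarantees
more than v. The two bounds on the critical parameter follow. -/

/-! ### Expectations over histories and long-run averages. -/

theorem moveProb1_nonneg {q : ℝ} (h0 : 0 ≤ q) (h1 : q ≤ 1) (a : Move1) : 0 ≤ moveProb1 q a := by
  cases a <;> simp only [moveProb1] <;> linarith

theorem moveProb2_nonneg {q : ℝ} (h0 : 0 ≤ q) (h1 : q ≤ 1) (b : Move2) : 0 ≤ moveProb2 q b := by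
  cases b <;> simp only [moveProb2] <;> linarith

theorem sum_state (f : State → ℝ) : ∑ s, f s = f State.low + f State.high := by
  rw [show (Finset.univ : Finset State) = {State.low, State.high} from rfl]
  rw [Finset.sum_pair (by decide)]

theorem sum_move1 (f : Move1 → ℝ) : ∑ a, f a = f Move1.T + f Move1.B := by
  rw [show (Finset.univ : Finset Move1) = {Move1.T, Move1.B} from rfl]
  rw [Finset.sum_pair (by decide)]

theorem sum_move2 (f : Move2 → ℝ) : ∑ b, f b = f Move2.L + f Move2.R := by
  rw [show (Finset.univ : Finset Move2) = {Move2.L, Move2.R} from rfl]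
  rw [Finset.sum_pair (by decide)]

theorem stateProb_nonneg (p θ₀ : unitInterval) (h : List Stage) (s : State) :
    0 ≤ stateProb p θ₀ h s := by
  have := p.2.1
  have := p.2.2
  have := θ₀.2.1
  have := θ₀.2.2
  rcases h with _ | ⟨⟨s', a, b⟩, h⟩
  · cases s <;> simp only [stateProb] <;> linarith
  · simp only [stateProb]
    split_ifs <;> linarith

theorem stateProb_high (p θ₀ : ℝ) (h : List Stage) :
    stateProb p θ₀ h State.high = 1 - stateProb p θ₀ h State.low := by
  rcases h with _ | ⟨⟨s', a, b⟩, h⟩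
  · simp [stateProb]
  · cases s' <;> simp [stateProb]

theorem playProb_nonneg (p θ₀ : unitInterval) (σ : Strategy1) (τ : Strategy2) (h : List Stage) :
    0 ≤ playProb p θ₀ σ τ h := by
  induction h with
  | nil => simp [playProb]
  | cons x h ih =>
    obtain ⟨s, a, b⟩ := x
    simp only [playProb]
    exact mul_nonneg (mul_nonneg (mul_nonneg ih (stateProb_nonneg p θ₀ h s))
      (moveProb1_nonneg (σ h s).2.1 (σ h s).2.2 a)) (moveProb2_nonneg (τ _).2.1 (τ _).2.2 b)

/-- Expectation of a function of the first `n` stages of the play. -/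
noncomputable def expect (p θ₀ : ℝ) (σ : Strategy1) (τ : Strategy2) (n : ℕ)
    (φ : List Stage → ℝ) : ℝ :=
  ∑ h : List.Vector Stage n, playProb p θ₀ σ τ h.toList * φ h.toList

/-- Adding one stage to a history of length `n`. -/
def vectorConsEquiv (n : ℕ) : Stage × List.Vector Stage n ≃ List.Vector Stage (n + 1) where
  toFun x := x.1 ::ᵥ x.2
  invFun v := (v.head, v.tail)
  left_inv x := by simp
  right_inv v := by simp

theorem expect_zero (p θ₀ : ℝ) (σ : Strategy1) (τ : Strategy2) (φ : List Stage → ℝ) :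
    expect p θ₀ σ τ 0 φ = φ [] := by
  have : ∀ h : List.Vector Stage 0, h.toList = [] := fun h => by
    rw [List.Vector.eq_nil h]; rfl
  simp only [expect, this, playProb, one_mul]
  simp

theorem expect_succ (p θ₀ : ℝ) (σ : Strategy1) (τ : Strategy2) (n : ℕ) (φ : List Stage → ℝ) :
    expect p θ₀ σ τ (n + 1) φ = expect p θ₀ σ τ n (fun h =>
      ∑ s, ∑ a, ∑ b, stateProb p θ₀ h s * moveProb1 (σ h s) a *
        moveProb2 (τ (h.map Prod.snd)) b * φ ((s, a, b) :: h)) := by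
  unfold expect
  rw [← (vectorConsEquiv n).sum_comp, Fintype.sum_prod_type_right]
  refine Finset.sum_congr rfl fun h _ => ?_
  rw [Fintype.sum_prod_type, Finset.mul_sum]
  refine Finset.sum_congr rfl fun s _ => ?_
  rw [Fintype.sum_prod_type, Finset.mul_sum]
  refine Finset.sum_congr rfl fun a _ => ?_
  rw [Finset.mul_sum]
  refine Finset.sum_congr rfl fun b _ => ?_
  simp only [vectorConsEquiv, Equiv.coe_fn_mk, List.Vector.toList_cons, playProb]
  ring

theorem expect_add (p θ₀ : ℝ) (σ : Strategy1) (τ : Strategy2) (n : ℕ) (φ ψ : List Stage → ℝ) :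
    expect p θ₀ σ τ n (fun h => φ h + ψ h) = expect p θ₀ σ τ n φ + expect p θ₀ σ τ n ψ := by
  simp only [expect, mul_add, Finset.sum_add_distrib]

theorem expect_congr (p θ₀ : ℝ) (σ : Strategy1) (τ : Strategy2) (n : ℕ) {φ ψ : List Stage → ℝ}
    (h : ∀ l, φ l = ψ l) : expect p θ₀ σ τ n φ = expect p θ₀ σ τ n ψ := by
  rw [funext h]

theorem expect_mono (p θ₀ : unitInterval) (σ : Strategy1) (τ : Strategy2) (n : ℕ)
    {φ ψ : List Stage → ℝ} (h : ∀ l, φ l ≤ ψ l) :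
    expect p θ₀ σ τ n φ ≤ expect p θ₀ σ τ n ψ :=
  Finset.sum_le_sum fun _ _ => mul_le_mul_of_nonneg_left (h _) (playProb_nonneg p θ₀ σ τ _)

theorem expect_const (p θ₀ : ℝ) (σ : Strategy1) (τ : Strategy2) (n : ℕ) (c : ℝ) :
    expect p θ₀ σ τ n (fun _ => c) = c := by
  induction n with
  | zero => rw [expect_zero]
  | succ n ih =>
    rw [expect_succ]
    refine Eq.trans (expect_congr _ _ _ _ _ fun h => ?_) ih
    simp only [sum_state, sum_move1, sum_move2, moveProb1, moveProb2, stateProb_high]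
    ring

/-- Expected total gain of Player 1 over the first `n` stages. -/
noncomputable def totalGain (p θ₀ : ℝ) (σ : Strategy1) (τ : Strategy2) (n : ℕ) : ℝ :=
  expect p θ₀ σ τ n (fun h => (h.map gain).sum)

theorem avgGain_eq (p θ₀ : ℝ) (σ : Strategy1) (τ : Strategy2) (n : ℕ) :
    avgGain p θ₀ σ τ n = totalGain p θ₀ σ τ n / n := rfl

/-- Conditional expectation of the gain of the next stage given the past. -/
noncomputable def stageGain (p θ₀ : ℝ) (σ : Strategy1) (τ : Strategy2) (h : List Stage) : ℝ :=
  stateProb p θ₀ h State.low * σ h State.low * τ (h.map Prod.snd) +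
    stateProb p θ₀ h State.high * (1 - σ h State.high) * (1 - τ (h.map Prod.snd))

theorem totalGain_succ (p θ₀ : ℝ) (σ : Strategy1) (τ : Strategy2) (n : ℕ) :
    totalGain p θ₀ σ τ (n + 1) =
      totalGain p θ₀ σ τ n + expect p θ₀ σ τ n (stageGain p θ₀ σ τ) := by
  unfold totalGain
  rw [expect_succ, ← expect_add]
  refine expect_congr _ _ _ _ _ fun h => ?_
  simp only [sum_state, sum_move1, sum_move2, moveProb1, moveProb2, stateProb_high, gain,
    List.map_cons, List.sum_cons, stageGain]
  ring

theorem totalGain_zero (p θ₀ : ℝ) (σ : Strategy1) (τ : Strategy2) :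
    totalGain p θ₀ σ τ 0 = 0 := by
  simp [totalGain, expect_zero]

theorem stageGain_mem (p θ₀ : unitInterval) (σ : Strategy1) (τ : Strategy2) (h : List Stage) :
    stageGain p θ₀ σ τ h ∈ Set.Icc (0 : ℝ) 1 := by
  have a0 := stateProb_nonneg p θ₀ h State.low
  have a1 := stateProb_nonneg p θ₀ h State.high
  have e := stateProb_high p θ₀ h
  have b := (σ h State.low).2
  have c := (σ h State.high).2
  have d := (τ (h.map Prod.snd)).2
  unfold stageGain
  refine ⟨add_nonneg (mul_nonneg (mul_nonneg a0 b.1) d.1)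
    (mul_nonneg (mul_nonneg a1 (sub_nonneg.2 c.2)) (sub_nonneg.2 d.2)), ?_⟩
  have h1 : stateProb p θ₀ h State.low * (σ h State.low) * (τ (h.map Prod.snd)) ≤
      stateProb p θ₀ h State.low :=
    mul_le_of_le_one_right (mul_nonneg a0 b.1) d.2 |>.trans (mul_le_of_le_one_right a0 b.2)
  have h2 : stateProb p θ₀ h State.high * (1 - σ h State.high) * (1 - τ (h.map Prod.snd)) ≤
      stateProb p θ₀ h State.high :=
    mul_le_of_le_one_right (mul_nonneg a1 (sub_nonneg.2 c.2)) (by linarith [d.1]) |>.trans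
      (mul_le_of_le_one_right a1 (by linarith [c.1]))
  linarith

theorem avgGain_mem (p θ₀ : unitInterval) (σ : Strategy1) (τ : Strategy2) (n : ℕ) :
    avgGain p θ₀ σ τ n ∈ Set.Icc (0 : ℝ) 1 := by
  have key : 0 ≤ totalGain p θ₀ σ τ n ∧ totalGain p θ₀ σ τ n ≤ n := by
    induction n with
    | zero => simp [totalGain_zero]
    | succ n ih =>
      rw [totalGain_succ]
      have h0 := expect_mono p θ₀ σ τ n fun l => (stageGain_mem p θ₀ σ τ l).1
      have h1 := expect_mono p θ₀ σ τ n fun l => (stageGain_mem p θ₀ σ τ l).2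
      rw [expect_const] at h0 h1
      push_cast
      exact ⟨by linarith [ih.1], by linarith [ih.2]⟩
  rw [avgGain_eq]
  exact ⟨div_nonneg key.1 n.cast_nonneg, div_le_one_of_le₀ key.2 n.cast_nonneg⟩

theorem avgGain_isBoundedUnder_le (p θ₀ : unitInterval) (σ : Strategy1) (τ : Strategy2) :
    IsBoundedUnder (· ≤ ·) atTop (avgGain p θ₀ σ τ) :=
  isBoundedUnder_of ⟨1, fun n => (avgGain_mem p θ₀ σ τ n).2⟩

theorem avgGain_isBoundedUnder_ge (p θ₀ : unitInterval) (σ : Strategy1) (τ : Strategy2) :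
    IsBoundedUnder (· ≥ ·) atTop (avgGain p θ₀ σ τ) :=
  isBoundedUnder_of ⟨0, fun n => (avgGain_mem p θ₀ σ τ n).1⟩

theorem tendsto_add_div (v C : ℝ) : Tendsto (fun n : ℕ => v + C / n) atTop (nhds v) := by
  simpa using (tendsto_const_div_atTop_nhds_zero_nat C).const_add v

theorem le_liminf_avgGain (p θ₀ : unitInterval) (σ : Strategy1) (τ : Strategy2) {v C : ℝ}
    (h : ∀ n : ℕ, n * v + C ≤ totalGain p θ₀ σ τ n) :
    v ≤ liminf (avgGain p θ₀ σ τ) atTop := by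
  rw [← (tendsto_add_div v C).liminf_eq]
  refine liminf_le_liminf ?_ (tendsto_add_div v C).isBoundedUnder_ge
    (avgGain_isBoundedUnder_le p θ₀ σ τ).isCoboundedUnder_ge
  filter_upwards [eventually_gt_atTop 0] with n hn
  have hn' : (0 : ℝ) < n := by exact_mod_cast hn
  rw [avgGain_eq, le_div_iff₀ hn', add_mul, div_mul_cancel₀ _ hn'.ne']
  linarith [h n]

theorem limsup_avgGain_le (p θ₀ : unitInterval) (σ : Strategy1) (τ : Strategy2) {v C : ℝ}
    (h : ∀ n : ℕ, totalGain p θ₀ σ τ n ≤ n * v + C) :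
    limsup (avgGain p θ₀ σ τ) atTop ≤ v := by
  rw [← (tendsto_add_div v C).limsup_eq]
  refine limsup_le_limsup ?_ (avgGain_isBoundedUnder_ge p θ₀ σ τ).isCoboundedUnder_le
    (tendsto_add_div v C).isBoundedUnder_le
  filter_upwards [eventually_gt_atTop 0] with n hn
  have hn' : (0 : ℝ) < n := by exact_mod_cast hn
  rw [avgGain_eq, div_le_iff₀ hn', add_mul, div_mul_cancel₀ _ hn'.ne']
  linarith [h n]

theorem liminf_le_limsup_avgGain (p θ₀ : unitInterval) (σ : Strategy1) (τ : Strategy2) :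
    liminf (avgGain p θ₀ σ τ) atTop ≤ limsup (avgGain p θ₀ σ τ) atTop :=
  liminf_le_limsup (avgGain_isBoundedUnder_le p θ₀ σ τ) (avgGain_isBoundedUnder_ge p θ₀ σ τ)

/-! ### Strategies of Player 1 that track the belief of Player 2. -/

/-- The internal state of a player who updates it by `U` according to the moves of Player 1. -/
def memory {Ω : Type*} (U : Ω → Move1 → Ω) (ω : Ω) : List (Move1 × Move2) → Ω
  | [] => ω
  | (a, _) :: h => U (memory U ω h) a

/-- The strategy of Player 1 who tracks the belief `θ` of Player 2 by `U` and plays `T` with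
probability `q θ s` in state `s`. -/
def beliefStrategy (q : unitInterval → State → unitInterval)
    (U : unitInterval → Move1 → unitInterval) (θ₀ : unitInterval) : Strategy1 :=
  fun h s => q (memory U θ₀ (h.map Prod.snd)) s

/-- Probability of the move `a` of Player 1 at belief `θ`. -/
noncomputable def moveProbAt (q : unitInterval → State → unitInterval) (θ : unitInterval)
    (a : Move1) : ℝ :=
  θ * moveProb1 (q θ State.low) a + (1 - θ) * moveProb1 (q θ State.high) a

/-- The update `U` of the belief follows Bayes' rule. -/
def IsBayes (p : ℝ) (q : unitInterval → State → unitInterval)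
    (U : unitInterval → Move1 → unitInterval) : Prop :=
  ∀ (θ : unitInterval) (a : Move1), moveProbAt q θ a * U θ a =
    p * (θ * moveProb1 (q θ State.low) a) + (1 - p) * ((1 - θ) * moveProb1 (q θ State.high) a)

/-- This is the sense in which `memory` is the belief of Player 2: it is the conditional probability
of `low` given the past moves, tested against functions φ of those moves. The play of Player 2
depends on the moves only, hence carries no information on the state. -/
theorem expect_mul_stateProb {p : ℝ} {q : unitInterval → State → unitInterval}
    {U : unitInterval → Move1 → unitInterval} (hU : IsBayes p q U) (θ₀ : unitInterval)
    (τ : Strategy2) (n : ℕ) (φ : List (Move1 × Move2) → ℝ) :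
    expect p θ₀ (beliefStrategy q U θ₀) τ n
        (fun h => φ (h.map Prod.snd) * stateProb p θ₀ h State.low) =
      expect p θ₀ (beliefStrategy q U θ₀) τ n
        (fun h => φ (h.map Prod.snd) * memory U θ₀ (h.map Prod.snd)) := by
  induction n generalizing φ with
  | zero => simp [expect_zero, stateProb, memory]
  | succ n ih =>
    rw [expect_succ, expect_succ]
    -- The weight of `high` is one minus that of `low`, so the induction hypothesis also handles
    -- sums over both states.
    have key : ∀ Φ₁ Φ₂ : List (Move1 × Move2) → ℝ,
        expect p θ₀ (beliefStrategy q U θ₀) τ n (fun h => Φ₁ (h.map Prod.snd) *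
          stateProb p θ₀ h State.low + Φ₂ (h.map Prod.snd) * stateProb p θ₀ h State.high) =
        expect p θ₀ (beliefStrategy q U θ₀) τ n (fun h => Φ₁ (h.map Prod.snd) *
          memory U θ₀ (h.map Prod.snd) +
            Φ₂ (h.map Prod.snd) * (1 - memory U θ₀ (h.map Prod.snd))) := by
      intro Φ₁ Φ₂
      have h1 := ih (fun l => Φ₁ l - Φ₂ l)
      calc _ = expect p θ₀ (beliefStrategy q U θ₀) τ n (fun h =>
            (Φ₁ (h.map Prod.snd) - Φ₂ (h.map Prod.snd)) * stateProb p θ₀ h State.low +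
              Φ₂ (h.map Prod.snd)) := by
              refine expect_congr _ _ _ _ _ fun h => ?_
              rw [stateProb_high]; ring
        _ = _ := by
              rw [expect_add, h1, ← expect_add]
              refine expect_congr _ _ _ _ _ fun h => ?_
              ring
    have e1 := key
      (fun l => ∑ a, ∑ b, moveProb1 (q (memory U θ₀ l) State.low) a * moveProb2 (τ l) b *
        (φ ((a, b) :: l) * p))
      (fun l => ∑ a, ∑ b, moveProb1 (q (memory U θ₀ l) State.high) a * moveProb2 (τ l) b *
        (φ ((a, b) :: l) * (1 - p)))
    have e2 := key
      (fun l => ∑ a, ∑ b, moveProb1 (q (memory U θ₀ l) State.low) a * moveProb2 (τ l) b *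
        (φ ((a, b) :: l) * U (memory U θ₀ l) a))
      (fun l => ∑ a, ∑ b, moveProb1 (q (memory U θ₀ l) State.high) a * moveProb2 (τ l) b *
        (φ ((a, b) :: l) * U (memory U θ₀ l) a))
    refine Eq.trans (Eq.trans (expect_congr _ _ _ _ _ fun h => ?_) (e1.trans ?_))
      (e2.symm.trans (expect_congr _ _ _ _ _ fun h => ?_))
    · simp only [sum_state, sum_move1, sum_move2, beliefStrategy, List.map_cons, stateProb,
        if_true, reduceCtorEq, if_false]
      ring
    · refine expect_congr _ _ _ _ _ fun h => ?_
      have hT := hU (memory U θ₀ (h.map Prod.snd)) Move1.T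
      have hB := hU (memory U θ₀ (h.map Prod.snd)) Move1.B
      simp only [moveProbAt, sum_move1, sum_move2] at hT hB ⊢
      linear_combination
        (-(moveProb2 (τ (h.map Prod.snd)) Move2.L * φ ((Move1.T, Move2.L) :: h.map Prod.snd) +
          moveProb2 (τ (h.map Prod.snd)) Move2.R * φ ((Move1.T, Move2.R) :: h.map Prod.snd))) * hT
        + (-(moveProb2 (τ (h.map Prod.snd)) Move2.L * φ ((Move1.B, Move2.L) :: h.map Prod.snd) +
          moveProb2 (τ (h.map Prod.snd)) Move2.R * φ ((Move1.B, Move2.R) :: h.map Prod.snd))) * hB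
    · simp only [sum_state, sum_move1, sum_move2, beliefStrategy, List.map_cons, memory]
      ring

theorem stateProb_cons (p θ₀ : ℝ) (x : Stage) (h : List Stage) (s : State) :
    stateProb p θ₀ (x :: h) s = if s = x.1 then p else 1 - p := rfl

/-- The expected increase of total gain plus potential in one stage. -/
noncomputable def drift (q : unitInterval → State → unitInterval)
    (U : unitInterval → Move1 → unitInterval) (g H : unitInterval → ℝ) (θ : unitInterval) : ℝ :=
  g θ + moveProbAt q θ Move1.T * H (U θ Move1.T) + moveProbAt q θ Move1.B * H (U θ Move1.B) - H θ

/-- `hL` and `hR` make Player 2 indifferent between `L` and `R`. The gain of a stage is therefore a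
function of the belief alone, and τ drops out of the drift. -/
theorem totalGain_add_potential_succ {p : ℝ} {q : unitInterval → State → unitInterval}
    {U : unitInterval → Move1 → unitInterval} (hU : IsBayes p q U) {g : unitInterval → ℝ}
    (hL : ∀ θ : unitInterval, θ * q θ State.low = g θ)
    (hR : ∀ θ : unitInterval, (1 - θ) * (1 - q θ State.high) = g θ)
    (H : unitInterval → ℝ) (θ₀ : unitInterval) (τ : Strategy2) (n : ℕ) :
    totalGain p θ₀ (beliefStrategy q U θ₀) τ (n + 1) +
        expect p θ₀ (beliefStrategy q U θ₀) τ (n + 1) (fun h => H (memory U θ₀ (h.map Prod.snd))) =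
      totalGain p θ₀ (beliefStrategy q U θ₀) τ n +
        expect p θ₀ (beliefStrategy q U θ₀) τ n (fun h => H (memory U θ₀ (h.map Prod.snd))) +
        expect p θ₀ (beliefStrategy q U θ₀) τ n
          (fun h => drift q U g H (memory U θ₀ (h.map Prod.snd))) := by
  have key : ∀ Φ₁ Φ₂ : List (Move1 × Move2) → ℝ,
      expect p θ₀ (beliefStrategy q U θ₀) τ n (fun h => Φ₁ (h.map Prod.snd) *
        stateProb p θ₀ h State.low + Φ₂ (h.map Prod.snd)) =
      expect p θ₀ (beliefStrategy q U θ₀) τ n (fun h => Φ₁ (h.map Prod.snd) *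
        memory U θ₀ (h.map Prod.snd) + Φ₂ (h.map Prod.snd)) := by
    intro Φ₁ Φ₂
    rw [expect_add, expect_add, expect_mul_stateProb hU]
  rw [totalGain_succ, expect_succ, add_assoc, add_assoc, ← expect_add, ← expect_add]
  congr 1
  have e := key
    (fun l => q (memory U θ₀ l) State.low * τ l -
      (1 - q (memory U θ₀ l) State.high) * (1 - τ l) +
      (∑ a, moveProb1 (q (memory U θ₀ l) State.low) a * H (U (memory U θ₀ l) a)) -
      (∑ a, moveProb1 (q (memory U θ₀ l) State.high) a * H (U (memory U θ₀ l) a)))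
    (fun l => (1 - q (memory U θ₀ l) State.high) * (1 - τ l) +
      (∑ a, moveProb1 (q (memory U θ₀ l) State.high) a * H (U (memory U θ₀ l) a)))
  refine Eq.trans (expect_congr _ _ _ _ _ fun h => ?_)
    (e.trans (expect_congr _ _ _ _ _ fun h => ?_))
  · simp only [sum_state, sum_move1, sum_move2, beliefStrategy, List.map_cons, stateProb_high,
      stageGain, memory, moveProb2]
    ring
  · have h1 := hL (memory U θ₀ (h.map Prod.snd))
    have h2 := hR (memory U θ₀ (h.map Prod.snd))
    simp only [drift, moveProbAt, sum_move1]
    linear_combination (τ (h.map Prod.snd) : ℝ) * h1 + (1 - (τ (h.map Prod.snd) : ℝ)) * h2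

theorem totalGain_ge_of_drift {p : unitInterval} {q : unitInterval → State → unitInterval}
    {U : unitInterval → Move1 → unitInterval} (hU : IsBayes p q U) {g : unitInterval → ℝ}
    (hL : ∀ θ : unitInterval, θ * q θ State.low = g θ)
    (hR : ∀ θ : unitInterval, (1 - θ) * (1 - q θ State.high) = g θ)
    {H : unitInterval → ℝ} {C v : ℝ} (hH : ∀ θ, |H θ| ≤ C) (hd : ∀ θ, v ≤ drift q U g H θ)
    (θ₀ : unitInterval) (τ : Strategy2) (n : ℕ) :
    n * v + -(2 * C) ≤ totalGain p θ₀ (beliefStrategy q U θ₀) τ n := by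
  have key : n * v + H θ₀ ≤ totalGain p θ₀ (beliefStrategy q U θ₀) τ n +
      expect p θ₀ (beliefStrategy q U θ₀) τ n (fun h => H (memory U θ₀ (h.map Prod.snd))) := by
    induction n with
    | zero => simp [totalGain_zero, expect_zero, memory]
    | succ n ih =>
      rw [totalGain_add_potential_succ hU hL hR]
      have := expect_mono p θ₀ (beliefStrategy q U θ₀) τ n
        fun h => hd (memory U θ₀ (h.map Prod.snd))
      rw [expect_const] at this
      push_cast
      linarith
  have h2 := expect_mono p θ₀ (beliefStrategy q U θ₀) τ n
    fun h => (abs_le.1 (hH (memory U θ₀ (h.map Prod.snd)))).2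
  rw [expect_const] at h2
  linarith [(abs_le.1 (hH θ₀)).1]

theorem totalGain_le_of_drift {p : unitInterval} {q : unitInterval → State → unitInterval}
    {U : unitInterval → Move1 → unitInterval} (hU : IsBayes p q U) {g : unitInterval → ℝ}
    (hL : ∀ θ : unitInterval, θ * q θ State.low = g θ)
    (hR : ∀ θ : unitInterval, (1 - θ) * (1 - q θ State.high) = g θ)
    {H : unitInterval → ℝ} {C v : ℝ} (hH : ∀ θ, |H θ| ≤ C) (hd : ∀ θ, drift q U g H θ ≤ v)
    (θ₀ : unitInterval) (τ : Strategy2) (n : ℕ) :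
    totalGain p θ₀ (beliefStrategy q U θ₀) τ n ≤ n * v + 2 * C := by
  have key : totalGain p θ₀ (beliefStrategy q U θ₀) τ n +
      expect p θ₀ (beliefStrategy q U θ₀) τ n (fun h => H (memory U θ₀ (h.map Prod.snd))) ≤
      n * v + H θ₀ := by
    induction n with
    | zero => simp [totalGain_zero, expect_zero, memory]
    | succ n ih =>
      rw [totalGain_add_potential_succ hU hL hR]
      have := expect_mono p θ₀ (beliefStrategy q U θ₀) τ n
        fun h => hd (memory U θ₀ (h.map Prod.snd))
      rw [expect_const] at this
      push_cast
      linarith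
  have h2 := expect_mono p θ₀ (beliefStrategy q U θ₀) τ n
    fun h => (abs_le.1 (hH (memory U θ₀ (h.map Prod.snd)))).1
  rw [expect_const] at h2
  linarith [(abs_le.1 (hH θ₀)).2]

/-! ### Potentials for Player 2. -/

/-- The state that follows `s` when a switch occurs. -/
def State.other : State → State
  | State.low => State.high
  | State.high => State.low

/-- Expected gain of Player 1 in state `s` if he plays `a` and Player 2 plays `L` with
probability `y`. -/
def gainAgainst (y : ℝ) : State → Move1 → ℝ
  | State.low, Move1.T => y
  | State.low, Move1.B => 0
  | State.high, Move1.T => 0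
  | State.high, Move1.B => 1 - y

/-- Player 2 keeps an internal state `ω` with a bound `α ω s` on the future excess gain of
Player 1 in state `s`. -/
theorem guarantees2_of_potential {Ω : Type*} (p θ₀ : unitInterval) {v C : ℝ}
    (U : Ω → Move1 → Ω) (ω₀ : Ω) (α : Ω → State → ℝ) (y : Ω → unitInterval)
    (hα : ∀ ω s, |α ω s| ≤ C)
    (h : ∀ ω s a, gainAgainst (y ω) s a + p * α (U ω a) s + (1 - p) * α (U ω a) s.other ≤
      α ω s + v) :
    Guarantees2 p θ₀ (fun l => y (memory U ω₀ l)) v := by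
  intro σ
  refine limsup_avgGain_le p θ₀ σ _ (C := 2 * C) fun n => ?_
  set τ : Strategy2 := fun l => y (memory U ω₀ l) with hτ
  -- The average is over the law of the state given the whole past, states included, since Player 1
  -- knows all of it.
  set Φ : List Stage → ℝ := fun l => ∑ s, stateProb p θ₀ l s * α (memory U ω₀ (l.map Prod.snd)) s
    with hΦ
  have hΦ' : ∀ l, |Φ l| ≤ C := by
    intro l
    have e := stateProb_high p θ₀ l
    have a0 := stateProb_nonneg p θ₀ l State.low
    have a1 := stateProb_nonneg p θ₀ l State.high
    have b0 := abs_le.1 (hα (memory U ω₀ (l.map Prod.snd)) State.low)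
    have b1 := abs_le.1 (hα (memory U ω₀ (l.map Prod.snd)) State.high)
    simp only [hΦ, sum_state]
    rw [abs_le]
    constructor
    · have := mul_le_mul_of_nonneg_left b0.1 a0
      have := mul_le_mul_of_nonneg_left b1.1 a1
      have : stateProb p θ₀ l State.low * C + stateProb p θ₀ l State.high * C = C := by
        rw [e]; ring
      linarith
    · have := mul_le_mul_of_nonneg_left b0.2 a0
      have := mul_le_mul_of_nonneg_left b1.2 a1
      have : stateProb p θ₀ l State.low * C + stateProb p θ₀ l State.high * C = C := by
        rw [e]; ring
      linarith
  have key : totalGain p θ₀ σ τ n + expect p θ₀ σ τ n Φ ≤ n * v + Φ [] := by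
    induction n with
    | zero => simp [totalGain_zero, expect_zero]
    | succ n ih =>
      rw [totalGain_succ, expect_succ, add_assoc, ← expect_add]
      have : ∀ l : List Stage, stageGain p θ₀ σ τ l + (∑ s, ∑ a, ∑ b, stateProb p θ₀ l s *
          moveProb1 (σ l s) a * moveProb2 (τ (l.map Prod.snd)) b * Φ ((s, a, b) :: l)) ≤
          Φ l + v := by
        intro l
        have hm : ∀ s a, 0 ≤ stateProb p θ₀ l s * moveProb1 (σ l s) a := fun s a =>
          mul_nonneg (stateProb_nonneg p θ₀ l s) (moveProb1_nonneg (σ l s).2.1 (σ l s).2.2 a)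
        have hh := fun s a => mul_le_mul_of_nonneg_left
          (h (memory U ω₀ (l.map Prod.snd)) s a) (hm s a)
        have h1 := hh State.low Move1.T
        have h2 := hh State.low Move1.B
        have h3 := hh State.high Move1.T
        have h4 := hh State.high Move1.B
        have e := stateProb_high p θ₀ l
        simp only [gainAgainst, State.other, moveProb1, e] at h1 h2 h3 h4
        simp only [hΦ, hτ, stageGain, sum_state, sum_move1, sum_move2, moveProb1, moveProb2,
          List.map_cons, stateProb_cons, if_true, reduceCtorEq, if_false, memory, e]
        linarith
      have := expect_mono p θ₀ σ τ n this
      rw [expect_add p θ₀ σ τ n Φ, expect_const] at this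
      push_cast
      linarith
  have h2 := expect_mono p θ₀ σ τ n fun l => (abs_le.1 (hΦ' l)).1
  rw [expect_const] at h2
  linarith [(abs_le.1 (hΦ' [])).2]

/-! ### The folded belief and the exact payoff of σ*. -/

/-- The distance of a belief to certainty. -/
def foldBelief (θ : ℝ) : ℝ := min θ (1 - θ)

/-- The effect of a move of `σ*` that does not reveal the state on the folded belief. -/
noncomputable def foldMap (p x : ℝ) : ℝ :=
  foldBelief (1 - p + (2 * p - 1) * (x / (1 - x)))

theorem foldBelief_symm (θ : ℝ) : foldBelief (1 - θ) = foldBelief θ := by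
  unfold foldBelief
  rw [min_comm, sub_sub_cancel]

theorem foldBelief_le_half (θ : ℝ) : foldBelief θ ≤ 1 / 2 := by
  unfold foldBelief
  rcases le_total θ (1 - θ) with h | h
  · rw [min_eq_left h]; linarith
  · rw [min_eq_right h]; linarith

theorem odds_mem {x : ℝ} (h0 : 0 ≤ x) (h1 : x ≤ 1 / 2) :
    0 ≤ x / (1 - x) ∧ x / (1 - x) ≤ 1 :=
  ⟨div_nonneg h0 (by linarith), (div_le_one (by linarith)).2 (by linarith)⟩

theorem foldMap_mem {p x : ℝ} (hp : 1 / 2 ≤ p) (h0 : 0 ≤ x) (h1 : x ≤ 1 / 2) :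
    foldMap p x ∈ Set.Icc (1 - p) (1 / 2) := by
  refine ⟨?_, foldBelief_le_half _⟩
  obtain ⟨a, b⟩ := odds_mem h0 h1
  unfold foldMap foldBelief
  refine le_min ?_ ?_ <;> nlinarith

/-- The probabilities used by `σ*`. -/
noncomputable def starPlay (θ : unitInterval) (s : State) : unitInterval :=
  ⟨playTReal θ s, playTReal_mem θ s⟩

/-- The belief update used by `σ*`. -/
noncomputable def starUpdate (p θ : unitInterval) (a : Move1) : unitInterval :=
  ⟨updateReal p θ a, updateReal_mem p θ a⟩

theorem belief_eq_memory (p θ₀ : unitInterval) (h : List Stage) :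
    belief p θ₀ h = memory (starUpdate p) θ₀ (h.map Prod.snd) := by
  induction h with
  | nil => rfl
  | cons x h ih =>
    obtain ⟨s, a, b⟩ := x
    simp only [belief, List.map_cons, memory, ih]
    rfl

theorem sigmaStar_eq (p θ₀ : unitInterval) :
    sigmaStar p θ₀ = beliefStrategy starPlay (starUpdate p) θ₀ := by
  funext h s
  simp only [sigmaStar, belief_eq_memory, beliefStrategy]
  rfl

theorem starPlay_low (θ : unitInterval) :
    (θ : ℝ) * starPlay θ State.low = foldBelief θ := by
  simp only [starPlay, playTReal, foldBelief]
  split_ifs with h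
  · rw [min_eq_left (by linarith)]; ring
  · push Not at h
    rw [min_eq_right (by linarith), mul_div_cancel₀]
    linarith

theorem starPlay_high (θ : unitInterval) :
    (1 - (θ : ℝ)) * (1 - starPlay θ State.high) = foldBelief θ := by
  simp only [starPlay, playTReal, foldBelief]
  split_ifs with h
  · have : (1 : ℝ) - θ ≠ 0 := by linarith
    rw [min_eq_left (by linarith)]; field_simp; ring
  · push Not at h
    rw [min_eq_right (by linarith)]; ring

/-- With `starPlay_low` and `starPlay_high`, this shows that the revealing move (`B` for θ < 1/2,
`T` for θ > 1/2) has the same probability as the stage gain, namely the folded belief. -/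
theorem moveProbAt_star (θ : unitInterval) :
    moveProbAt starPlay θ Move1.T = 1 - θ ∧ moveProbAt starPlay θ Move1.B = θ := by
  have h1 := starPlay_low θ
  have h2 := starPlay_high θ
  simp only [moveProbAt, moveProb1]
  constructor <;> linarith

theorem isBayes_star (p : unitInterval) : IsBayes p starPlay (starUpdate p) := by
  intro θ a
  obtain ⟨hT, hB⟩ := moveProbAt_star θ
  cases a
  · rw [hT]
    rcases lt_trichotomy (θ : ℝ) (1 / 2) with h | h | h
    · have : (1 : ℝ) - θ ≠ 0 := by linarith
      simp only [starUpdate, starPlay, updateReal, playTReal, moveProb1, if_neg h.not_ge, if_pos h.le]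
      field_simp
    · simp only [starUpdate, starPlay, updateReal, playTReal, moveProb1, h]
      norm_num
      ring
    · have : (θ : ℝ) ≠ 0 := by linarith
      simp only [starUpdate, starPlay, updateReal, playTReal, moveProb1, if_neg h.not_ge, if_pos h.le]
      field_simp
      ring
  · rw [hB]
    rcases lt_trichotomy (θ : ℝ) (1 / 2) with h | h | h
    · have : (1 : ℝ) - θ ≠ 0 := by linarith
      simp only [starUpdate, starPlay, updateReal, playTReal, moveProb1, if_neg h.not_ge, if_pos h.le]
      field_simp
      ring
    · simp only [starUpdate, starPlay, updateReal, playTReal, moveProb1, h]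
      norm_num
      ring
    · have : (θ : ℝ) ≠ 0 := by linarith
      simp only [starUpdate, starPlay, updateReal, playTReal, moveProb1, if_neg h.not_ge, if_pos h.le]
      field_simp
      ring

theorem fold_starUpdate {p : unitInterval} (hp : 1 / 2 ≤ (p : ℝ)) (θ : unitInterval) :
    ((θ : ℝ) < 1 / 2 → foldBelief (starUpdate p θ Move1.T) = foldMap p (foldBelief θ) ∧
      foldBelief (starUpdate p θ Move1.B) = 1 - p) ∧
    (1 / 2 ≤ (θ : ℝ) → foldBelief (starUpdate p θ Move1.B) = foldMap p (foldBelief θ) ∧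
      foldBelief (starUpdate p θ Move1.T) = 1 - p) := by
  constructor
  · intro h
    have e : foldBelief θ = θ := min_eq_left (by linarith)
    have : (1 : ℝ) - θ ≠ 0 := by linarith
    constructor
    · rw [e]
      unfold foldMap
      congr 1
      simp only [starUpdate, updateReal, if_neg h.not_ge]
      field_simp
      ring
    · simp only [starUpdate, updateReal, if_neg h.not_ge]
      exact min_eq_left (by linarith)
  · intro h
    have e : foldBelief θ = 1 - θ := min_eq_right (by linarith)
    have : (θ : ℝ) ≠ 0 := by linarith
    constructor
    · rw [e]
      unfold foldMap
      rw [← foldBelief_symm]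
      congr 1
      simp only [starUpdate, updateReal, if_pos h, sub_sub_cancel]
      field_simp
      ring
    · simp only [starUpdate, updateReal, if_pos h]
      exact min_eq_right (by linarith)

theorem drift_star {p : unitInterval} (hp : 1 / 2 ≤ (p : ℝ)) (H : ℝ → ℝ) (θ : unitInterval) :
    drift starPlay (starUpdate p) (fun θ => foldBelief θ) (fun θ => H (foldBelief θ)) θ =
      foldBelief θ + (1 - foldBelief θ) * H (foldMap p (foldBelief θ)) +
        foldBelief θ * H (1 - p) - H (foldBelief θ) := by
  obtain ⟨hT, hB⟩ := moveProbAt_star θ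
  obtain ⟨h1, h2⟩ := fold_starUpdate hp θ
  simp only [drift, hT, hB]
  rcases lt_or_ge (θ : ℝ) (1 / 2) with h | h
  · rw [(h1 h).1, (h1 h).2, show foldBelief θ = θ from min_eq_left (by linarith)]
  · rw [(h2 h).1, (h2 h).2, show foldBelief θ = 1 - θ from min_eq_right (by linarith)]
    ring

theorem foldBelief_mem (θ : unitInterval) : foldBelief θ ∈ Set.Icc (0 : ℝ) (1 / 2) :=
  ⟨le_min θ.2.1 (by linarith [θ.2.2]), foldBelief_le_half _⟩

/-- `ℓ x` is the expected time until `σ*` reveals the state, starting from the folded belief `x`. -/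
def IsRevealTime (p : ℝ) (ℓ : ℝ → ℝ) : Prop :=
  (∀ x ∈ Set.Icc (1 - p) (1 / 2), ℓ x = 1 + (1 - x) * ℓ (foldMap p x)) ∧
    ∃ C, ∀ x ∈ Set.Icc (1 - p) (1 / 2), |ℓ x| ≤ C

/-- Extension of the expected reveal time to all folded beliefs. -/
noncomputable def extendTime (p : ℝ) (ℓ : ℝ → ℝ) (x : ℝ) : ℝ :=
  if 1 - p ≤ x then ℓ x else 1 + (1 - x) * ℓ (foldMap p x)

/-- An initial belief may lie outside [1 - p, p], but `foldMap` enters the invariant interval at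
once, so a single use of the recursion defines the time there. -/
theorem extendTime_eq {p : ℝ} (hp : 1 / 2 ≤ p) {ℓ : ℝ → ℝ} (hℓ : IsRevealTime p ℓ) {x : ℝ}
    (h0 : 0 ≤ x) (h1 : x ≤ 1 / 2) :
    extendTime p ℓ x = 1 + (1 - x) * extendTime p ℓ (foldMap p x) := by
  have e : extendTime p ℓ (foldMap p x) = ℓ (foldMap p x) := if_pos (foldMap_mem hp h0 h1).1
  rw [e]
  unfold extendTime
  split_ifs with h
  · exact hℓ.1 x ⟨h, h1⟩
  · rfl

theorem extendTime_bounded {p : ℝ} (hp : 1 / 2 ≤ p) {ℓ : ℝ → ℝ} (hℓ : IsRevealTime p ℓ) :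
    ∃ C, ∀ x ∈ Set.Icc (0 : ℝ) (1 / 2), |extendTime p ℓ x| ≤ C := by
  obtain ⟨C, hC⟩ := hℓ.2
  refine ⟨1 + C, fun x hx => ?_⟩
  unfold extendTime
  split_ifs with h
  · linarith [hC x ⟨h, hx.2⟩]
  · have := hC _ (foldMap_mem hp hx.1 hx.2)
    calc |1 + (1 - x) * ℓ (foldMap p x)| ≤ |1| + |(1 - x) * ℓ (foldMap p x)| := abs_add_le _ _
      _ ≤ 1 + C := by
        rw [abs_one, abs_mul, abs_of_nonneg (by linarith [hx.2])]
        have := abs_nonneg (ℓ (foldMap p x))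
        nlinarith [hx.1]

/-- A renewal argument: gains count revelations, and ℓ decreases by one per stage on average until
the next revelation. The constant 1 makes the potential vanish at 1 - p, where a revelation restarts
the process. -/
theorem drift_star_revealTime {p : unitInterval} (hp : 1 / 2 ≤ (p : ℝ)) {ℓ : ℝ → ℝ}
    (hℓ : IsRevealTime p ℓ) {v : ℝ} (hv : v * ℓ (1 - p) = 1) (θ : unitInterval) :
    drift starPlay (starUpdate p) (fun θ => foldBelief θ)
      (fun θ => (fun x => 1 - v * extendTime p ℓ x) (foldBelief θ)) θ = v := by
  rw [drift_star hp (fun x => 1 - v * extendTime p ℓ x)]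
  have hx := foldBelief_mem θ
  have e : extendTime p ℓ (1 - p) = ℓ (1 - p) := if_pos le_rfl
  rw [e, extendTime_eq hp hℓ hx.1 hx.2]
  linear_combination -(foldBelief θ) * hv

theorem totalGain_star {p : unitInterval} (hp : 1 / 2 ≤ (p : ℝ)) {ℓ : ℝ → ℝ}
    (hℓ : IsRevealTime p ℓ) {v : ℝ} (hv : v * ℓ (1 - p) = 1) :
    ∃ C, ∀ (θ₀ : unitInterval) (τ : Strategy2) (n : ℕ),
      n * v + -C ≤ totalGain p θ₀ (sigmaStar p θ₀) τ n ∧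
        totalGain p θ₀ (sigmaStar p θ₀) τ n ≤ n * v + C := by
  obtain ⟨C, hC⟩ := extendTime_bounded hp hℓ
  have hH : ∀ θ : unitInterval,
      |(fun x => 1 - v * extendTime p ℓ x) (foldBelief θ)| ≤ 1 + |v| * C := by
    intro θ
    refine (abs_sub _ _).trans ?_
    rw [abs_one, abs_mul]
    have := mul_le_mul_of_nonneg_left (hC _ (foldBelief_mem θ)) (abs_nonneg v)
    linarith
  refine ⟨2 * (1 + |v| * C), fun θ₀ τ n => ?_⟩
  rw [sigmaStar_eq]
  exact ⟨totalGain_ge_of_drift (isBayes_star p) starPlay_low starPlay_high hH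
      (fun θ => (drift_star_revealTime hp hℓ hv θ).ge) θ₀ τ n,
    totalGain_le_of_drift (isBayes_star p) starPlay_low starPlay_high hH
      (fun θ => (drift_star_revealTime hp hℓ hv θ).le) θ₀ τ n⟩

theorem guarantees1_star {p : unitInterval} (hp : 1 / 2 ≤ (p : ℝ)) {ℓ : ℝ → ℝ}
    (hℓ : IsRevealTime p ℓ) {v : ℝ} (hv : v * ℓ (1 - p) = 1) (θ₀ : unitInterval) :
    Guarantees1 p θ₀ (sigmaStar p θ₀) v := by
  obtain ⟨C, hC⟩ := totalGain_star hp hℓ hv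
  exact fun τ => le_liminf_avgGain p θ₀ _ τ fun n => (hC θ₀ τ n).1

theorem le_of_guarantees1_star {p : unitInterval} (hp : 1 / 2 ≤ (p : ℝ)) {ℓ : ℝ → ℝ}
    (hℓ : IsRevealTime p ℓ) {v v' : ℝ} (hv : v * ℓ (1 - p) = 1) {θ₀ : unitInterval}
    (h : Guarantees1 p θ₀ (sigmaStar p θ₀) v') : v' ≤ v := by
  obtain ⟨C, hC⟩ := totalGain_star hp hℓ hv
  -- The payoff of σ* is the same against every τ, so any opponent serves as a test; this one always
  -- plays `R`.
  exact (h fun _ => 0).trans ((liminf_le_limsup_avgGain p θ₀ _ _).trans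
    (limsup_avgGain_le p θ₀ _ _ fun n => (hC θ₀ _ n).2))

/-! ### Certificates of optimality from Player 2's side. -/

/-- The two continuation values in the certificate of Player 2: `(a, b)` such that the expected
reveal times from the pure states are `1 + b` and `1 + a`. -/
def continuation (ε : Bool) (u w : ℝ) : ℝ × ℝ :=
  if ε then (u, w - u) else (w, u - w)

/-- Update of the internal state of Player 2: the number of non-revealing moves since the last
revealing one, and the orientation. -/
def certificateUpdate (ε : ℕ → Bool) : ℕ × Bool → Move1 → ℕ × Bool
  | (k, true), Move1.T => (k + 1, ε k)
  | (_, true), Move1.B => (0, true)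
  | (_, false), Move1.T => (0, false)
  | (k, false), Move1.B => (k + 1, !ε k)

/-- The numbers `1 + b k` and `1 + a k` are the values at the two pure states of an affine function
that takes the value `u k` at 1 - p and `w k` at p. With `y = v * a k`, three of the four pairs of
state and move, those used by σ*, give equality in the potential inequality. The fourth is the
revealing move played in the wrong state; it does not pay because `b k ≤ w 0`. The bound `u k, w k ≤
u 0` keeps `y` at most 1. -/
theorem guarantees2_of_certificate (p θ₀ : unitInterval) {v C : ℝ} {ε : ℕ → Bool} {u w : ℕ → ℝ}
    (hv0 : 0 ≤ v) (hv : v * u 0 = 1)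
    (hu : ∀ k, u k = 1 + (1 - p) * (continuation (ε k) (u (k + 1)) (w (k + 1))).2 +
      p * (continuation (ε k) (u (k + 1)) (w (k + 1))).1)
    (hw : ∀ k, w k = 1 + p * (continuation (ε k) (u (k + 1)) (w (k + 1))).2 +
      (1 - p) * (continuation (ε k) (u (k + 1)) (w (k + 1))).1)
    (hu0 : ∀ k, 0 ≤ u k) (hw0 : ∀ k, 0 ≤ w k) (hu1 : ∀ k, u k ≤ u 0) (hw1 : ∀ k, w k ≤ u 0)
    (huw : ∀ k, |u k - w k| ≤ w 0) (hC : u 0 ≤ C) :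
    ∃ τ, Guarantees2 p θ₀ τ v := by
  set a : ℕ → ℝ := fun k => (continuation (ε k) (u (k + 1)) (w (k + 1))).1 with ha
  set b : ℕ → ℝ := fun k => (continuation (ε k) (u (k + 1)) (w (k + 1))).2 with hb
  have ha0 : ∀ k, 0 ≤ a k ∧ a k ≤ u 0 := by
    intro k
    simp only [ha, continuation]
    split_ifs
    · exact ⟨hu0 _, hu1 _⟩
    · exact ⟨hw0 _, hw1 _⟩
  have hbw : ∀ k, |b k| ≤ w 0 := by
    intro k
    simp only [hb, continuation]
    split_ifs
    · rw [abs_sub_comm]; exact huw _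
    · exact huw _
  have hy : ∀ k, v * a k ∈ unitInterval := fun k =>
    ⟨mul_nonneg hv0 (ha0 k).1, by rw [← hv]; exact mul_le_mul_of_nonneg_left (ha0 k).2 hv0⟩
  let α : ℕ × Bool → State → ℝ := fun ω s => match ω, s with
    | (k, true), State.low => 1 - v * (1 + b k)
    | (k, true), State.high => 1 - v * (1 + a k)
    | (k, false), State.low => 1 - v * (1 + a k)
    | (k, false), State.high => 1 - v * (1 + b k)
  let y : ℕ × Bool → unitInterval := fun ω => match ω with
    | (k, true) => ⟨v * a k, hy k⟩
    | (k, false) => unitInterval.symm ⟨v * a k, hy k⟩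
  have hA : ∀ k, |1 - v * (1 + a k)| ≤ 1 + v * (1 + C) := by
    intro k
    have := ha0 k
    rw [abs_le]
    constructor <;> nlinarith
  have hB : ∀ k, |1 - v * (1 + b k)| ≤ 1 + v * (1 + C) := by
    intro k
    have := abs_le.1 (hbw k)
    have := hw1 0
    rw [abs_le]
    constructor <;> nlinarith
  refine ⟨_, guarantees2_of_potential p θ₀ (C := 1 + v * (1 + C)) (certificateUpdate ε) (0, true)
    α y ?_ ?_⟩
  · rintro ⟨k, _ | _⟩ (_ | _)
    exacts [hA k, hB k, hB k, hA k]
  · have key : ∀ k, v * (b k) ≤ v * w 0 := fun k =>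
      mul_le_mul_of_nonneg_left (abs_le.1 (hbw k)).2 hv0
    have e1 : ∀ k o, p * α (k, o) State.low + (1 - p) * α (k, o) State.high =
        if o then 1 - v * w k else 1 - v * u k := by
      intro k o
      cases o
      · simp only [α, Bool.false_eq_true, if_false]
        rw [hu k]; ring
      · simp only [α, if_true]
        rw [hw k]; ring
    have e2 : ∀ k o, p * α (k, o) State.high + (1 - p) * α (k, o) State.low =
        if o then 1 - v * u k else 1 - v * w k := by
      intro k o
      cases o
      · simp only [α, Bool.false_eq_true, if_false]
        rw [hw k]; ring
      · simp only [α, if_true]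
        rw [hu k]; ring
    have c1 : ∀ k, (ε k = true → a k = u (k + 1) ∧ b k = w (k + 1) - u (k + 1)) ∧
        (ε k = false → a k = w (k + 1) ∧ b k = u (k + 1) - w (k + 1)) := by
      intro k
      simp only [ha, hb, continuation]
      constructor <;> intro h <;> simp [h]
    rintro ⟨k, _ | _⟩ (_ | _) (_ | _) <;>
      simp only [certificateUpdate, State.other, add_assoc, e1, e2] <;>
      (rcases hε : ε k with _ | _ <;>
        [obtain ⟨q1, q2⟩ := (c1 k).2 hε; obtain ⟨q1, q2⟩ := (c1 k).1 hε]) <;>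
      have q3 := key k <;>
      simp only [gainAgainst, y, α, unitInterval.coe_symm_eq, Bool.not_true, Bool.not_false,
        Bool.false_eq_true, if_true, if_false, q1, q2] at q3 ⊢ <;>
      linarith

theorem foldMap_of_le {p x : ℝ} (hp : 1 / 2 ≤ p) (h : x ≤ 1 / 3) :
    foldMap p x = 1 - p + (2 * p - 1) * (x / (1 - x)) := by
  have : x / (1 - x) ≤ 1 / 2 := by rw [div_le_iff₀ (by linarith)]; linarith
  exact min_eq_left (by nlinarith)

theorem foldMap_of_ge {p x : ℝ} (hp : 1 / 2 ≤ p) (h : 1 / 3 ≤ x) (h1 : x < 1) :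
    foldMap p x = p - (2 * p - 1) * (x / (1 - x)) := by
  have : 1 / 2 ≤ x / (1 - x) := by rw [le_div_iff₀ (by linarith)]; linarith
  unfold foldMap foldBelief
  rw [min_eq_right (by nlinarith)]
  ring

theorem sigmaStarOptimal_of_certificate {p : unitInterval} (hp : 1 / 2 ≤ (p : ℝ)) {ℓ : ℝ → ℝ}
    (hℓ : IsRevealTime p ℓ) {ε : ℕ → Bool} {u w : ℕ → ℝ} (h0 : u 0 = ℓ (1 - p)) (hpos : 0 < u 0)
    (hu : ∀ k, u k = 1 + (1 - p) * (continuation (ε k) (u (k + 1)) (w (k + 1))).2 +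
      p * (continuation (ε k) (u (k + 1)) (w (k + 1))).1)
    (hw : ∀ k, w k = 1 + p * (continuation (ε k) (u (k + 1)) (w (k + 1))).2 +
      (1 - p) * (continuation (ε k) (u (k + 1)) (w (k + 1))).1)
    (hu0 : ∀ k, 0 ≤ u k) (hw0 : ∀ k, 0 ≤ w k) (hu1 : ∀ k, u k ≤ u 0) (hw1 : ∀ k, w k ≤ u 0)
    (huw : ∀ k, |u k - w k| ≤ w 0) : SigmaStarOptimal p := by
  intro θ₀
  have hv : 1 / u 0 * u 0 = 1 := div_mul_cancel₀ _ hpos.ne'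
  have h1 : Guarantees1 p θ₀ (sigmaStar p θ₀) (1 / u 0) :=
    guarantees1_star hp hℓ (by rw [← h0]; exact hv) θ₀
  exact ⟨1 / u 0, ⟨⟨_, h1⟩, guarantees2_of_certificate p θ₀ (by positivity) hv hu hw hu0 hw0 hu1
    hw1 huw le_rfl⟩, h1⟩

/-- Here 1 - p ≥ 1/3, so only the second branch of `foldMap` occurs and the recursion has the affine
solution 3 - x / p. All its tangents coincide, so the certificate is constant: its values at 1 - p
and p are 4 - 1 / p and 2. -/
theorem sigmaStarOptimal_of_le_two_thirds {p : unitInterval} (hp : 1 / 2 ≤ (p : ℝ))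
    (hp' : (p : ℝ) ≤ 2 / 3) : SigmaStarOptimal p := by
  have hp0 : (p : ℝ) ≠ 0 := by linarith
  have hi : (1 : ℝ) / p ≤ 2 := by rw [div_le_iff₀ (by linarith)]; linarith
  have hi0 : 0 < (1 : ℝ) / p := by apply div_pos <;> linarith
  refine sigmaStarOptimal_of_certificate hp (ℓ := fun x => 3 - x / p) ⟨fun x hx => ?_, 6, ?_⟩
    (ε := fun _ => false) (u := fun _ => 4 - 1 / p) (w := fun _ => 2) ?_ ?_ ?_ ?_ ?_ ?_ ?_ ?_ ?_
  · have hx1 := hx.1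
    have hx2 := hx.2
    have : 1 - x ≠ 0 := by linarith
    simp only [foldMap_of_ge hp (show 1 / 3 ≤ x by linarith) (by linarith)]
    field_simp
    ring
  · intro x hx
    have hx1 := hx.1
    have hx2 := hx.2
    have h1 : x / p = x * (1 / p) := by ring
    have : 0 ≤ x * (1 / p) := mul_nonneg (by linarith) hi0.le
    have : x * (1 / p) ≤ 1 := by nlinarith
    simp only [h1, abs_le]
    constructor <;> linarith
  · field_simp
    ring
  · linarith
  · intro _
    simp only [continuation]
    norm_num
    field_simp
    ring
  · intro _
    simp only [continuation]
    norm_num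
    field_simp
    ring
  · intro _; linarith
  · intro _; norm_num
  · intro _; rfl
  · intro _; linarith
  · intro _
    rw [abs_le]
    constructor <;> linarith

/-! ### Convexity and slope bounds for the iterates of the reveal time. -/

/-- Iterates of the recursion for the expected reveal time. -/
noncomputable def timeIter (p : ℝ) : ℕ → ℝ → ℝ
  | 0, _ => 7 / 10
  | n + 1, x => 1 + (1 - x) * timeIter p n (foldMap p x)

/-- Whether the non-revealing move of `σ*` keeps the orientation of the belief. -/
noncomputable def orientation (x : ℝ) : ℝ := if x ≤ 1 / 3 then 1 else -1

/-- Iterates of the recursion for minus the derivative of the expected reveal time. -/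
noncomputable def slopeIter (p : ℝ) : ℕ → ℝ → ℝ
  | 0, _ => 0
  | n + 1, x => timeIter p n (foldMap p x) +
      orientation x * ((2 * p - 1) / (1 - x)) * slopeIter p n (foldMap p x)

/-- The tangent with slope `-e` to the reveal time at `s`, evaluated at `t`. -/
def tangent (l e s t : ℝ) : ℝ := l + (s - t) * e

/-- On each branch (1 - t) F(t) is affine in t, so 1 + (1 - t) A(F t) is affine whenever A is. The
recursion thus carries tangents to tangents, and the new one is determined by the values of the old
one at p and 1 - p. -/
theorem tangent_step_of_le {p x l e : ℝ} (hp : 1 / 2 ≤ p) (h : x ≤ 1 / 3) (t : ℝ) :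
    tangent (1 + (1 - x) * l) (l + orientation x * ((2 * p - 1) / (1 - x)) * e) x t =
      1 + t * tangent l e (foldMap p x) p + (1 - 2 * t) * tangent l e (foldMap p x) (1 - p) := by
  have : 1 - x ≠ 0 := by linarith
  rw [foldMap_of_le hp h, orientation, if_pos h]
  unfold tangent
  field_simp
  ring

theorem tangent_step_of_gt {p x l e : ℝ} (hp : 1 / 2 ≤ p) (h : 1 / 3 < x) (h1 : x < 1) (t : ℝ) :
    tangent (1 + (1 - x) * l) (l + orientation x * ((2 * p - 1) / (1 - x)) * e) x t =
      1 + t * tangent l e (foldMap p x) (1 - p) + (1 - 2 * t) * tangent l e (foldMap p x) p := by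
  have : 1 - x ≠ 0 := by linarith
  rw [foldMap_of_ge hp h.le h1, orientation, if_neg h.not_ge]
  unfold tangent
  field_simp
  ring

/-- The tangent to the `n`-th iterate at `s`, evaluated at `t`. -/
noncomputable def tangentIter (p : ℝ) (n : ℕ) (s t : ℝ) : ℝ :=
  tangent (timeIter p n s) (slopeIter p n s) s t

theorem tangentIter_self (p : ℝ) (n : ℕ) (s : ℝ) : tangentIter p n s s = timeIter p n s := by
  simp [tangentIter, tangent]

theorem tangentIter_succ_of_le {p x : ℝ} (hp : 1 / 2 ≤ p) (h : x ≤ 1 / 3) (n : ℕ) (t : ℝ) :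
    tangentIter p (n + 1) x t = 1 + t * tangentIter p n (foldMap p x) p +
      (1 - 2 * t) * tangentIter p n (foldMap p x) (1 - p) :=
  tangent_step_of_le hp h t

theorem tangentIter_succ_of_gt {p x : ℝ} (hp : 1 / 2 ≤ p) (h : 1 / 3 < x) (h1 : x < 1) (n : ℕ)
    (t : ℝ) : tangentIter p (n + 1) x t = 1 + t * tangentIter p n (foldMap p x) (1 - p) +
      (1 - 2 * t) * tangentIter p n (foldMap p x) p :=
  tangent_step_of_gt hp h h1 t

/-- The tangents to the `n`-th iterate and their reflections lie below it. -/
def IsConvexIter (p : ℝ) (n : ℕ) : Prop :=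
  ∀ s ∈ Set.Icc (1 - p) (1 / 2), ∀ t ∈ Set.Icc (1 - p) (1 / 2),
    tangentIter p n s t ≤ timeIter p n t ∧ tangentIter p n s (1 - t) ≤ timeIter p n t

/-- The slopes of the `n`-th iterate are small. -/
def IsFlatIter (p : ℝ) (n : ℕ) : Prop :=
  ∀ s ∈ Set.Icc (1 - p) (1 / 2), tangentIter p n s p ≤ tangentIter p n s (1 - p) ∧
    tangentIter p n s (1 - p) ≤ 2 * tangentIter p n s p

theorem odds_combination {p t l e s : ℝ} (ht : t < 1) :
    t * tangent l e s p + (1 - 2 * t) * tangent l e s (1 - p) =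
      (1 - t) * tangent l e s (1 - p + (2 * p - 1) * (t / (1 - t))) := by
  have : 1 - t ≠ 0 := by linarith
  unfold tangent
  field_simp
  ring

theorem odds_combination_swap {p t l e s : ℝ} (ht : t < 1) :
    t * tangent l e s (1 - p) + (1 - 2 * t) * tangent l e s p =
      (1 - t) * tangent l e s (1 - (1 - p + (2 * p - 1) * (t / (1 - t)))) := by
  have : 1 - t ≠ 0 := by linarith
  unfold tangent
  field_simp
  ring

/-- The unfolded image 1 - p + (2p - 1) t / (1 - t) is F t or 1 - F t according to the branch. Since
`IsConvexIter` is invariant under reflection, both orders of the two tangent values are bounded in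
either case. -/
theorem IsConvexIter.le_foldMap {p : ℝ} (hp : 1 / 2 ≤ p) (hp1 : p < 1) {n : ℕ}
    (hc : IsConvexIter p n) {s t : ℝ}
    (hs : s ∈ Set.Icc (1 - p) (1 / 2)) (ht : t ∈ Set.Icc (1 - p) (1 / 2)) :
    t * tangentIter p n s p + (1 - 2 * t) * tangentIter p n s (1 - p) ≤
        (1 - t) * timeIter p n (foldMap p t) ∧
      t * tangentIter p n s (1 - p) + (1 - 2 * t) * tangentIter p n s p ≤
        (1 - t) * timeIter p n (foldMap p t) := by
  have ht1 : t < 1 := by linarith [ht.2]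
  have hm := foldMap_mem hp (by linarith [ht.1] : 0 ≤ t) ht.2
  obtain ⟨h1, h2⟩ := hc s hs _ hm
  unfold tangentIter
  rw [odds_combination ht1, odds_combination_swap ht1]
  have key : tangent (timeIter p n s) (slopeIter p n s) s
        (1 - p + (2 * p - 1) * (t / (1 - t))) ≤ timeIter p n (foldMap p t) ∧
      tangent (timeIter p n s) (slopeIter p n s) s
        (1 - (1 - p + (2 * p - 1) * (t / (1 - t)))) ≤ timeIter p n (foldMap p t) := by
    rcases le_or_gt t (1 / 3) with h | h
    · rw [← foldMap_of_le hp h]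
      exact ⟨h1, h2⟩
    · have e : 1 - (1 - p + (2 * p - 1) * (t / (1 - t))) = foldMap p t := by
        rw [foldMap_of_ge hp h.le ht1]; ring
      have e' : 1 - p + (2 * p - 1) * (t / (1 - t)) = 1 - foldMap p t := by rw [← e]; ring
      rw [e, e']
      exact ⟨h2, h1⟩
  exact ⟨mul_le_mul_of_nonneg_left key.1 (by linarith),
    mul_le_mul_of_nonneg_left key.2 (by linarith)⟩

/-- `IsConvexIter` expresses convexity of the symmetric extension to [1 - p, p]. The direct
inequality at t is `le_foldMap`. With u and w the values of the old tangent at 1 - p and p, the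
reflected inequality differs from it by (1 - 2t)(w - 2u) or (1 - 2t)(u - 2w), and both are
nonpositive by flatness. -/
theorem IsConvexIter.succ {p : ℝ} (hp : 1 / 2 ≤ p) (hp1 : p < 1) {n : ℕ}
    (hc : IsConvexIter p n) (hf : IsFlatIter p n) : IsConvexIter p (n + 1) := by
  intro s hs t ht
  have hs1 : s < 1 := by linarith [hs.2]
  have hm := foldMap_mem hp (by linarith [hs.1] : 0 ≤ s) hs.2
  obtain ⟨a, b⟩ := hf _ hm
  obtain ⟨c, d⟩ := hc.le_foldMap hp hp1 hm ht
  have ht2 : 0 ≤ 1 - 2 * t := by linarith [ht.2]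
  simp only [timeIter]
  rcases le_or_gt s (1 / 3) with h | h
  · rw [tangentIter_succ_of_le hp h, tangentIter_succ_of_le hp h]
    exact ⟨by linarith, by nlinarith⟩
  · rw [tangentIter_succ_of_gt hp h hs1, tangentIter_succ_of_gt hp h hs1]
    exact ⟨by linarith, by nlinarith⟩

theorem IsFlatIter.slope_nonneg_succ {p : ℝ} (hp : 1 / 2 ≤ p) (hp1 : p < 1) {n : ℕ}
    (hf : IsFlatIter p n) {s : ℝ} (hs : s ∈ Set.Icc (1 - p) (1 / 2)) :
    tangentIter p (n + 1) s p ≤ tangentIter p (n + 1) s (1 - p) := by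
  have hs1 : s < 1 := by linarith [hs.2]
  have hm := foldMap_mem hp (by linarith [hs.1] : 0 ≤ s) hs.2
  obtain ⟨a, b⟩ := hf _ hm
  rcases le_or_gt s (1 / 3) with h | h
  · rw [tangentIter_succ_of_le hp h, tangentIter_succ_of_le hp h]
    nlinarith
  · rw [tangentIter_succ_of_gt hp h hs1, tangentIter_succ_of_gt hp h hs1]
    nlinarith

/-- The two tangent inequalities between s and 1 - p show that the descent is steepest at 1 - p, so
the tangent there is the lowest one at p. -/
theorem IsConvexIter.tangent_ge {p : ℝ} (hp : 1 / 2 ≤ p) {n : ℕ} (hc : IsConvexIter p n) {s : ℝ}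
    (hs : s ∈ Set.Icc (1 - p) (1 / 2)) :
    tangentIter p n (1 - p) p ≤ tangentIter p n s p := by
  have hq : 1 - p ∈ Set.Icc (1 - p) (1 / 2) := ⟨le_rfl, by linarith⟩
  rcases hs.1.eq_or_lt with h | h
  · rw [← h]
  have a := (hc _ hq _ hs).1
  have b := (hc _ hs _ hq).1
  unfold tangentIter tangent at *
  have hs2 := hs.2
  have he : slopeIter p n s ≤ slopeIter p n (1 - p) := by
    have : (s - (1 - p)) * (slopeIter p n s - slopeIter p n (1 - p)) ≤ 0 := by linarith
    by_contra hh
    push Not at hh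
    have := mul_pos (sub_pos.2 h) (sub_pos.2 hh)
    linarith
  have h3 := mul_le_mul_of_nonneg_left he (show 0 ≤ p - s by linarith)
  linarith

/-- Among all tangents, the one at 1 - p has the largest value at 1 - p and the smallest at p, so
the factor-two bound need only be checked there. -/
theorem IsConvexIter.isFlatIter {p : ℝ} (hp : 1 / 2 ≤ p) {n : ℕ} (hc : IsConvexIter p n)
    (h0 : ∀ s ∈ Set.Icc (1 - p) (1 / 2), tangentIter p n s p ≤ tangentIter p n s (1 - p))
    (h1 : tangentIter p n (1 - p) (1 - p) ≤ 2 * tangentIter p n (1 - p) p) :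
    IsFlatIter p n := by
  intro s hs
  have hq : 1 - p ∈ Set.Icc (1 - p) (1 / 2) := ⟨le_rfl, by linarith⟩
  have a := (hc _ hs _ hq).1
  have b := hc.tangent_ge hp hs
  rw [← tangentIter_self] at a
  exact ⟨h0 s hs, by linarith⟩

/-- For a belief written as X / (X + Y), the fractional map F becomes linear on pairs (X, Y) with
the same total X + Y multiplied by 1 - x. This keeps iterated computations free of division. -/
theorem odds_step_of_le {p x X Y : ℝ} (hp : 1 / 2 ≤ p) (hx : x ∈ Set.Icc (1 - p) (1 / 2))
    (hS : 0 < X + Y) (e : x * (X + Y) = X) (h : 2 * X ≤ Y) :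
    x ≤ 1 / 3 ∧ 0 < ((2 * p - 1) * X + (1 - p) * Y) + (p * Y - (2 * p - 1) * X) ∧
      foldMap p x * (((2 * p - 1) * X + (1 - p) * Y) + (p * Y - (2 * p - 1) * X)) =
        (2 * p - 1) * X + (1 - p) * Y := by
  have hx2 := hx.2
  have h3 : x ≤ 1 / 3 := by
    by_contra hh
    push Not at hh
    nlinarith
  have hY : Y = (1 - x) * (X + Y) := by linarith
  have hY0 : 0 < Y := by rw [hY]; exact mul_pos (by linarith) hS
  have hd : x / (1 - x) * Y = X := by
    rw [div_mul_eq_mul_div, div_eq_iff (by linarith), hY]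
    linear_combination (1 - x) * e
  refine ⟨h3, by linarith, ?_⟩
  rw [foldMap_of_le hp h3]
  linear_combination (2 * p - 1) * hd

theorem odds_step_of_gt {p x X Y : ℝ} (hp : 1 / 2 ≤ p) (hx : x ∈ Set.Icc (1 - p) (1 / 2))
    (hS : 0 < X + Y) (e : x * (X + Y) = X) (h : Y < 2 * X) :
    1 / 3 < x ∧ 0 < (p * Y - (2 * p - 1) * X) + ((2 * p - 1) * X + (1 - p) * Y) ∧
      foldMap p x * ((p * Y - (2 * p - 1) * X) + ((2 * p - 1) * X + (1 - p) * Y)) =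
        p * Y - (2 * p - 1) * X := by
  have hx2 := hx.2
  have h3 : 1 / 3 < x := by
    by_contra hh
    push Not at hh
    nlinarith
  have hY : Y = (1 - x) * (X + Y) := by linarith
  have hY0 : 0 < Y := by rw [hY]; exact mul_pos (by linarith) hS
  have hd : x / (1 - x) * Y = X := by
    rw [div_mul_eq_mul_div, div_eq_iff (by linarith), hY]
    linear_combination (1 - x) * e
  refine ⟨h3, by linarith, ?_⟩
  rw [foldMap_of_ge hp h3.le (by linarith)]
  linear_combination (-(2 * p - 1)) * hd

/-! ### The orbit of 1 - p for 2/3 < p ≤ 0.7191. -/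

/-- The orbit of the belief after a revealing move, as long as Player 1 does not reveal the state. -/
noncomputable def orbit (p : ℝ) (k : ℕ) : ℝ := (foldMap p)^[k] (1 - p)

theorem orbit_zero (p : ℝ) : orbit p 0 = 1 - p := rfl

theorem orbit_succ (p : ℝ) (k : ℕ) : orbit p (k + 1) = foldMap p (orbit p k) :=
  Function.iterate_succ_apply' _ _ _

theorem orbit_mem {p : ℝ} (hp : 1 / 2 ≤ p) (hp1 : p ≤ 1) (k : ℕ) :
    orbit p k ∈ Set.Icc (1 - p) (1 / 2) := by
  induction k with
  | zero => exact ⟨le_rfl, by rw [orbit_zero]; linarith⟩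
  | succ k ih =>
    rw [orbit_succ]
    exact foldMap_mem hp (by linarith [ih.1]) ih.2

/-- With p = 2/3 + s the orbit is given by pairs of polynomials in s, and each comparison with 1/3
becomes a polynomial inequality on 0 < s ≤ 21/400. -/
theorem orbit_start {p : ℝ} (h : 2 / 3 < p) (h' : p ≤ 0.7191) :
    orbit p 0 ≤ 1 / 3 ∧ 1 / 3 < orbit p 1 ∧ 1 / 3 < orbit p 2 ∧ 1 / 3 < orbit p 3 ∧
      orbit p 4 ≤ 1 / 3 ∧ 1 / 3 < orbit p 5 := by
  have hp : 1 / 2 ≤ p := by linarith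
  have hm := fun k => orbit_mem hp (by norm_num at h'; linarith) k
  obtain ⟨s, rfl⟩ : ∃ s, p = 2 / 3 + s := ⟨p - 2 / 3, by ring⟩
  have hs0 : 0 < s := by linarith
  -- A short fraction slightly above 0.7191 - 2/3.
  have hs1 : s ≤ 21 / 400 := by norm_num at h'; linarith
  have h2 : 0 < s ^ 2 := by positivity
  have h3 : 0 < s ^ 3 := by positivity
  have h4 : 0 < s ^ 4 := by positivity
  have h5 : 0 < s ^ 5 := by positivity
  have h6 : 0 < s ^ 6 := by positivity
  have b2 : s ^ 2 ≤ 21 / 400 * s := by nlinarith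
  have b3 : s ^ 3 ≤ 21 / 400 * s ^ 2 := by nlinarith
  have b4 : s ^ 4 ≤ 21 / 400 * s ^ 3 := by nlinarith
  have b5 : s ^ 5 ≤ 21 / 400 * s ^ 4 := by nlinarith
  obtain ⟨a0, S1, e1⟩ := odds_step_of_le (X := 1 - (2 / 3 + s)) (Y := 2 / 3 + s) hp (hm 0)
    (by norm_num) (by rw [orbit_zero]; ring) (by linarith)
  rw [← orbit_succ] at e1
  obtain ⟨a1, S2, e2⟩ := odds_step_of_gt hp (hm 1) S1 e1 (sub_pos.1 (lt_of_lt_of_eq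
    (show 0 < 1 / 3 - s - 9 * s ^ 2 by linarith) (by ring)))
  rw [← orbit_succ] at e2
  obtain ⟨a2, S3, e3⟩ := odds_step_of_gt hp (hm 2) S2 e2 (sub_pos.1 (lt_of_lt_of_eq
    (show 0 < 9 * s ^ 2 + 27 * s ^ 3 by linarith) (by ring)))
  rw [← orbit_succ] at e3
  obtain ⟨a3, S4, e4⟩ := odds_step_of_gt hp (hm 3) S3 e3 (sub_pos.1 (lt_of_lt_of_eq
    (show 0 < 1 / 9 + s / 3 - 5 * s ^ 2 - 45 * s ^ 3 - 81 * s ^ 4 by linarith) (by ring)))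
  rw [← orbit_succ] at e4
  obtain ⟨a4, S5, e5⟩ := odds_step_of_le hp (hm 4) S4 e4 (sub_nonneg.1 (le_of_le_of_eq
    (show 0 ≤ s / 3 - 2 * s ^ 2 - 42 * s ^ 3 - 189 * s ^ 4 - 243 * s ^ 5 by linarith) (by ring)))
  rw [← orbit_succ] at e5
  obtain ⟨a5, -, -⟩ := odds_step_of_gt hp (hm 5) S5 e5 (sub_pos.1 (lt_of_lt_of_eq
    (show 0 < 1 / 27 + 23 * s ^ 3 + 198 * s ^ 4 + 648 * s ^ 5 + 729 * s ^ 6 by linarith)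
    (by ring)))
  exact ⟨a0, a1, a2, a3, a4, a5⟩

/-- Along the fixed branch pattern of `orbit_start`, six steps express the tangent at 1 - p through
a tangent of the iterate of index n - 6, whose flatness gives the claim. For n < 6 the expansion
ends at the initial constant 7/10. -/
theorem flat_at_start {p : ℝ} (h : 2 / 3 < p) (h' : p ≤ 0.7191) {n : ℕ}
    (hn : ∀ m, m + 6 = n → IsFlatIter p m) :
    tangentIter p n (1 - p) (1 - p) ≤ 2 * tangentIter p n (1 - p) p := by
  have hp : 1 / 2 ≤ p := by linarith
  have hm := fun k => orbit_mem hp (by norm_num at h'; linarith) k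
  obtain ⟨a0, a1, a2, a3, a4, a5⟩ := orbit_start h h'
  have rl : ∀ {k : ℕ}, orbit p k ≤ 1 / 3 → ∀ n, _ ∧ _ := fun {k} hk n =>
    ⟨orbit_succ p k ▸ tangentIter_succ_of_le hp hk n p,
      orbit_succ p k ▸ tangentIter_succ_of_le hp hk n (1 - p)⟩
  have rg : ∀ {k : ℕ}, 1 / 3 < orbit p k → ∀ n, _ ∧ _ := fun {k} hk n =>
    ⟨orbit_succ p k ▸ tangentIter_succ_of_gt hp hk (by linarith [(hm k).2]) n p,
      orbit_succ p k ▸ tangentIter_succ_of_gt hp hk (by linarith [(hm k).2]) n (1 - p)⟩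
  have r0 := rl a0
  have r1 := rg a1
  have r2 := rg a2
  have r3 := rg a3
  have r4 := rl a4
  have r5 := rg a5
  have z : ∀ k t, tangentIter p 0 (orbit p k) t = 7 / 10 := fun k t => by
    simp [tangentIter, tangent, timeIter, slopeIter]
  change tangentIter p n (orbit p 0) (1 - p) ≤ 2 * tangentIter p n (orbit p 0) p
  simp only [zero_add, Nat.reduceAdd] at r0 r1 r2 r3 r4 r5
  have h6 := fun m hm' => hn m hm' _ (hm 6)
  obtain ⟨s, rfl⟩ : ∃ s, p = 2 / 3 + s := ⟨p - 2 / 3, by ring⟩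
  have hs0 : 0 < s := by linarith
  have hs1 : s ≤ 21 / 400 := by norm_num at h'; linarith
  have h2 : 0 < s ^ 2 := by positivity
  have h3 : 0 < s ^ 3 := by positivity
  have h4 : 0 < s ^ 4 := by positivity
  have h5 : 0 < s ^ 5 := by positivity
  have b2 : s ^ 2 ≤ 21 / 400 * s := by nlinarith
  have b3 : s ^ 3 ≤ 21 / 400 * s ^ 2 := by nlinarith
  have b4 : s ^ 4 ≤ 21 / 400 * s ^ 3 := by nlinarith
  rw [← sub_nonneg]
  match n, hn with
  | 0, _ => rw [z, z]; norm_num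
  | 1, _ =>
    rw [(r0 _).1, (r0 _).2, z, z]
    exact le_of_le_of_eq (show 0 ≤ 1 - 21 / 10 * s by linarith) (by ring)
  | 2, _ =>
    rw [(r0 _).1, (r0 _).2, (r1 _).1, (r1 _).2, z, z]
    exact le_of_le_of_eq (show 0 ≤ 23 / 30 - 13 / 2 * s - 63 / 10 * s ^ 2 by linarith) (by ring)
  | 3, _ =>
    rw [(r0 _).1, (r0 _).2, (r1 _).1, (r1 _).2, (r2 _).1, (r2 _).2, z, z]
    exact le_of_le_of_eq (show 0 ≤ 2 / 3 - 8 * s - 27 / 10 * s ^ 2 + 189 / 10 * s ^ 3 by linarith)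
      (by ring)
  | 4, _ =>
    rw [(r0 _).1, (r0 _).2, (r1 _).1, (r1 _).2, (r2 _).1, (r2 _).2, (r3 _).1, (r3 _).2, z, z]
    exact le_of_le_of_eq (show 0 ≤ 53 / 90 - 289 / 30 * s - 91 / 10 * s ^ 2 - 9 / 2 * s ^ 3 -
      567 / 10 * s ^ 4 by linarith) (by ring)
  | 5, _ =>
    rw [(r0 _).1, (r0 _).2, (r1 _).1, (r1 _).2, (r2 _).1, (r2 _).2, (r3 _).1, (r3 _).2,
      (r4 _).1, (r4 _).2, z, z]
    exact le_of_le_of_eq (show 0 ≤ 5 / 9 - 101 / 10 * s - 6 * s ^ 2 + 141 / 5 * s ^ 3 +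
      513 / 10 * s ^ 4 + 1701 / 10 * s ^ 5 by linarith) (by ring)
  | m + 6, _ =>
    obtain ⟨f1, f2⟩ := h6 m rfl
    rw [(r0 _).1, (r0 _).2, (r1 _).1, (r1 _).2, (r2 _).1, (r2 _).2, (r3 _).1, (r3 _).2,
      (r4 _).1, (r4 _).2, (r5 _).1, (r5 _).2]
    generalize tangentIter (2 / 3 + s) m (orbit (2 / 3 + s) 6) (2 / 3 + s) = w at *
    generalize tangentIter (2 / 3 + s) m (orbit (2 / 3 + s) 6) (1 - (2 / 3 + s)) = u at *
    have hw : 0 ≤ w := by linarith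
    -- The quantity to be bounded is affine in u and w. It is split into a constant and multiples of
    -- 2w - u and w, both nonnegative by flatness, with coefficients that are positive for s > 0.
    have k0 : 0 ≤ 5 / 9 - 10 * s - 3 * s ^ 2 + 48 * s ^ 3 + 108 * s ^ 4 + 243 * s ^ 5 := by
      linarith
    have k1 : 0 ≤ (1 / 27 + s + 10 * s ^ 2 + 71 * s ^ 3 + 315 * s ^ 4 + 729 * s ^ 5 +
      729 * s ^ 6) * (2 * w - u) := mul_nonneg (by positivity) (by linarith)
    have k2 : 0 ≤ (s / 3 + 10 * s ^ 2 + 66 * s ^ 3 + 189 * s ^ 4 + 243 * s ^ 5) * w :=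
      mul_nonneg (by positivity) hw
    exact le_of_le_of_eq (add_nonneg (add_nonneg k0 k1) k2) (by ring)

/-- Convexity at n + 1 needs convexity and flatness at n, while flatness at the starting point looks
six indices back; hence strong induction on both properties. -/
theorem isConvexIter_and_isFlatIter {p : ℝ} (h : 2 / 3 < p) (h' : p ≤ 0.7191) (n : ℕ) :
    IsConvexIter p n ∧ IsFlatIter p n := by
  have hp : 1 / 2 ≤ p := by linarith
  have hp1 : p < 1 := by norm_num at h'; linarith
  induction n using Nat.strong_induction_on with
  | _ n ih =>
    have start := flat_at_start h h' (n := n) fun m hm => (ih m (by omega)).2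
    rcases n with _ | n
    · constructor
      · intro s _ t _
        simp [tangentIter, tangent, timeIter, slopeIter]
      · intro s _
        norm_num [tangentIter, tangent, timeIter, slopeIter]
    · obtain ⟨hc, hf⟩ := ih n (by omega)
      have hc' := hc.succ hp hp1 hf
      exact ⟨hc', hc'.isFlatIter hp (fun s hs => hf.slope_nonneg_succ hp hp1 hs) start⟩

/-! ### Passage to the limit and optimality for 2/3 < p ≤ 0.7191. -/

theorem timeIter_mem {p : ℝ} (hp : 1 / 2 ≤ p) (hp1 : p < 1) (n : ℕ) {x : ℝ}
    (hx : x ∈ Set.Icc (1 - p) (1 / 2)) :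
    0 ≤ timeIter p n x ∧ timeIter p n x ≤ 1 / (1 - p) := by
  have hq : 0 < 1 - p := by linarith
  have h1 : 1 / (1 - p) * (1 - p) = 1 := div_mul_cancel₀ _ hq.ne'
  have h2 : 1 ≤ 1 / (1 - p) := by rw [le_div_iff₀ hq]; linarith
  induction n generalizing x with
  | zero => simp only [timeIter]; constructor <;> linarith
  | succ n ih =>
    obtain ⟨a, b⟩ := ih (foldMap_mem hp (by linarith [hx.1]) hx.2)
    obtain ⟨hx1, hx2⟩ := hx
    simp only [timeIter]
    constructor <;> nlinarith

theorem abs_timeIter_sub_le {p : ℝ} (hp : 1 / 2 ≤ p) (hp1 : p < 1) (n : ℕ) {x : ℝ}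
    (hx : x ∈ Set.Icc (1 - p) (1 / 2)) :
    |timeIter p (n + 1) x - timeIter p n x| ≤ p ^ n := by
  induction n generalizing x with
  | zero =>
    obtain ⟨hx1, hx2⟩ := hx
    simp only [timeIter, pow_zero, abs_le]
    constructor <;> linarith
  | succ n ih =>
    have h := ih (foldMap_mem hp (by linarith [hx.1]) hx.2)
    have e : timeIter p (n + 1 + 1) x - timeIter p (n + 1) x =
        (1 - x) * (timeIter p (n + 1) (foldMap p x) - timeIter p n (foldMap p x)) := by
      simp only [timeIter]; ring
    rw [e, abs_mul, abs_of_nonneg (by linarith [hx.2]), pow_succ']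
    exact mul_le_mul (by linarith [hx.1]) h (abs_nonneg _) (by linarith)

theorem exists_revealTime {p : ℝ} (hp : 1 / 2 ≤ p) (hp1 : p < 1) :
    ∃ ℓ : ℝ → ℝ, IsRevealTime p ℓ ∧ ∀ x ∈ Set.Icc (1 - p) (1 / 2),
      0 ≤ ℓ x ∧ ℓ x ≤ 1 / (1 - p) ∧ Tendsto (fun n => timeIter p n x) atTop (nhds (ℓ x)) := by
  have hlim : ∀ x, ∃ l, x ∈ Set.Icc (1 - p) (1 / 2) →
      Tendsto (fun n => timeIter p n x) atTop (nhds l) := by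
    intro x
    by_cases hx : x ∈ Set.Icc (1 - p) (1 / 2)
    · obtain ⟨l, hl⟩ := cauchySeq_tendsto_of_complete (cauchySeq_of_le_geometric p 1 hp1
        (f := fun n => timeIter p n x) fun n => by
          rw [dist_comm, Real.dist_eq, one_mul]; exact abs_timeIter_sub_le hp hp1 n hx)
      exact ⟨l, fun _ => hl⟩
    · exact ⟨0, fun h => absurd h hx⟩
  choose ℓ hℓ using hlim
  have hb : ∀ x ∈ Set.Icc (1 - p) (1 / 2), 0 ≤ ℓ x ∧ ℓ x ≤ 1 / (1 - p) := fun x hx =>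
    ⟨ge_of_tendsto' (hℓ x hx) fun n => (timeIter_mem hp hp1 n hx).1,
      le_of_tendsto' (hℓ x hx) fun n => (timeIter_mem hp hp1 n hx).2⟩
  refine ⟨ℓ, ⟨fun x hx => ?_, 1 / (1 - p), fun x hx => ?_⟩, fun x hx =>
    ⟨(hb x hx).1, (hb x hx).2, hℓ x hx⟩⟩
  · have h1 := (tendsto_add_atTop_iff_nat 1).2 (hℓ x hx)
    have h2 := ((hℓ _ (foldMap_mem hp (by linarith [hx.1]) hx.2)).const_mul (1 - x)).const_add 1
    exact tendsto_nhds_unique h1 h2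
  · rw [abs_of_nonneg (hb x hx).1]
    exact (hb x hx).2

theorem abs_slope_coeff_le {p x : ℝ} (hp : 1 / 2 ≤ p) (hx : x ∈ Set.Icc (1 - p) (1 / 2)) :
    |orientation x * ((2 * p - 1) / (1 - x))| ≤ 2 * (2 * p - 1) := by
  have h1 : |orientation x| = 1 := by
    unfold orientation
    split_ifs <;> simp
  obtain ⟨_, hx2⟩ := hx
  rw [abs_mul, h1, one_mul, abs_of_nonneg (div_nonneg (by linarith) (by linarith)),
    div_le_iff₀ (by linarith)]
  nlinarith

/-- Successive differences contract by 2(2p - 1) ≤ 0.8764 up to an error p ^ n ≤ (9/10) ^ n. The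
constant 50 works because 1 + 0.8764 · 50 ≤ 45. -/
theorem abs_slopeIter_sub_le {p : ℝ} (hp : 1 / 2 ≤ p) (hp1 : p ≤ 0.7191) (n : ℕ) {x : ℝ}
    (hx : x ∈ Set.Icc (1 - p) (1 / 2)) :
    |slopeIter p (n + 1) x - slopeIter p n x| ≤ 50 * (9 / 10) ^ n := by
  norm_num at hp1
  induction n generalizing x with
  | zero =>
    simp only [slopeIter, timeIter, pow_zero, abs_le]
    constructor <;> linarith
  | succ n ih =>
    have hm := foldMap_mem hp (by linarith [hx.1]) hx.2
    have h := ih hm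
    have ht := abs_timeIter_sub_le hp (by linarith) n hm
    have hc := abs_slope_coeff_le hp hx
    have e : slopeIter p (n + 1 + 1) x - slopeIter p (n + 1) x =
        (timeIter p (n + 1) (foldMap p x) - timeIter p n (foldMap p x)) +
        orientation x * ((2 * p - 1) / (1 - x)) *
          (slopeIter p (n + 1) (foldMap p x) - slopeIter p n (foldMap p x)) := by
      rw [show slopeIter p (n + 1 + 1) x = timeIter p (n + 1) (foldMap p x) + orientation x *
        ((2 * p - 1) / (1 - x)) * slopeIter p (n + 1) (foldMap p x) from rfl,
        show slopeIter p (n + 1) x = timeIter p n (foldMap p x) + orientation x *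
        ((2 * p - 1) / (1 - x)) * slopeIter p n (foldMap p x) from rfl]
      ring
    rw [e]
    have hpow : p ^ n ≤ (9 / 10 : ℝ) ^ n := pow_le_pow_left₀ (by linarith) (by linarith) n
    have h9 : (0 : ℝ) < (9 / 10) ^ n := by positivity
    calc _ ≤ p ^ n + 2 * (2 * p - 1) * (50 * (9 / 10) ^ n) :=
          (abs_add_le _ _).trans (add_le_add ht (by
            rw [abs_mul]; exact mul_le_mul hc h (abs_nonneg _) (by linarith)))
      _ ≤ 50 * (9 / 10) ^ (n + 1) := by rw [pow_succ]; nlinarith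

theorem exists_slope {p : ℝ} (hp : 1 / 2 ≤ p) (hp1 : p ≤ 0.7191) :
    ∃ e : ℝ → ℝ, ∀ x ∈ Set.Icc (1 - p) (1 / 2),
      Tendsto (fun n => slopeIter p n x) atTop (nhds (e x)) := by
  have hlim : ∀ x, ∃ l, x ∈ Set.Icc (1 - p) (1 / 2) →
      Tendsto (fun n => slopeIter p n x) atTop (nhds l) := by
    intro x
    by_cases hx : x ∈ Set.Icc (1 - p) (1 / 2)
    · obtain ⟨l, hl⟩ := cauchySeq_tendsto_of_complete (cauchySeq_of_le_geometric (9 / 10) 50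
        (by norm_num) (f := fun n => slopeIter p n x) fun n => by
          rw [dist_comm, Real.dist_eq]; exact abs_slopeIter_sub_le hp hp1 n hx)
      exact ⟨l, fun _ => hl⟩
    · exact ⟨0, fun h => absurd h hx⟩
  choose e he using hlim
  exact ⟨e, he⟩

/-- The certificate consists of the values at 1 - p and p of the limiting tangents along the orbit,
and ε records the branch. Convexity gives u_k, w_k ≤ u_0 and w_0 ≤ w_k; flatness then gives 0 ≤ u_k
- w_k ≤ u_0 - w_0 ≤ w_0. -/
theorem sigmaStarOptimal_of_two_thirds_lt {p : unitInterval} (h : 2 / 3 < (p : ℝ))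
    (h' : (p : ℝ) ≤ 0.7191) : SigmaStarOptimal p := by
  have hp : 1 / 2 ≤ (p : ℝ) := by linarith
  have hp1 : (p : ℝ) < 1 := by norm_num at h'; linarith
  obtain ⟨ℓ, hℓ, hb⟩ := exists_revealTime hp hp1
  obtain ⟨e, he⟩ := exists_slope hp h'
  have hm := orbit_mem hp hp1.le
  have hq : (1 : ℝ) - p ∈ Set.Icc (1 - (p : ℝ)) (1 / 2) := ⟨le_rfl, by linarith⟩
  have hlim : ∀ k t, Tendsto (fun n => tangentIter p n (orbit p k) t) atTop
      (nhds (tangent (ℓ (orbit p k)) (e (orbit p k)) (orbit p k) t)) := fun k t =>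
    (hb _ (hm k)).2.2.add ((he _ (hm k)).const_mul _)
  have hrec : ∀ k, e (orbit p k) = ℓ (orbit p (k + 1)) + orientation (orbit p k) *
      ((2 * p - 1) / (1 - orbit p k)) * e (orbit p (k + 1)) := fun k => by
    have h1 := (tendsto_add_atTop_iff_nat 1).2 (he _ (hm k))
    have h2 := (hb _ (hm (k + 1))).2.2.add ((he _ (hm (k + 1))).const_mul
      (orientation (orbit p k) * ((2 * p - 1) / (1 - orbit p k))))
    rw [orbit_succ] at h2 ⊢
    exact tendsto_nhds_unique h1 h2
  have hstep : ∀ k, ℓ (orbit p k) = 1 + (1 - orbit p k) * ℓ (orbit p (k + 1)) := fun k => by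
    rw [orbit_succ]; exact hℓ.1 _ (hm k)
  have inv := fun n => isConvexIter_and_isFlatIter h h' n
  have hu1 : ∀ k, tangent (ℓ (orbit p k)) (e (orbit p k)) (orbit p k) (1 - p) ≤
      tangent (ℓ (orbit p 0)) (e (orbit p 0)) (orbit p 0) (1 - p) := fun k =>
    le_of_tendsto_of_tendsto' (hlim k _) (hlim 0 _) fun n => by
      have := ((inv n).1 _ (hm k) _ hq).1
      rwa [← tangentIter_self] at this
  have hw1 : ∀ k, tangent (ℓ (orbit p k)) (e (orbit p k)) (orbit p k) p ≤
      tangent (ℓ (orbit p 0)) (e (orbit p 0)) (orbit p 0) (1 - p) := fun k =>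
    le_of_tendsto_of_tendsto' (hlim k _) (hlim 0 _) fun n => by
      have := ((inv n).1 _ (hm k) _ hq).2
      rwa [← tangentIter_self, sub_sub_cancel] at this
  have hwu : ∀ k, tangent (ℓ (orbit p k)) (e (orbit p k)) (orbit p k) p ≤
      tangent (ℓ (orbit p k)) (e (orbit p k)) (orbit p k) (1 - p) := fun k =>
    le_of_tendsto_of_tendsto' (hlim k _) (hlim k _) fun n => ((inv n).2 _ (hm k)).1
  have hu2 : ∀ k, tangent (ℓ (orbit p k)) (e (orbit p k)) (orbit p k) (1 - p) ≤
      2 * tangent (ℓ (orbit p k)) (e (orbit p k)) (orbit p k) p := fun k =>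
    le_of_tendsto_of_tendsto' (hlim k _) ((hlim k _).const_mul 2) fun n =>
      ((inv n).2 _ (hm k)).2
  have hw2 : ∀ k, tangent (ℓ (orbit p 0)) (e (orbit p 0)) (orbit p 0) p ≤
      tangent (ℓ (orbit p k)) (e (orbit p k)) (orbit p k) p := fun k =>
    le_of_tendsto_of_tendsto' (hlim 0 _) (hlim k _) fun n => (inv n).1.tangent_ge hp (hm k)
  have hpos : 0 < tangent (ℓ (orbit p 0)) (e (orbit p 0)) (orbit p 0) (1 - p) := by
    have : tangent (ℓ (orbit p 0)) (e (orbit p 0)) (orbit p 0) (1 - p) = ℓ (orbit p 0) := by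
      simp [tangent, orbit_zero]
    rw [this, hstep 0]
    have := (hb _ (hm 1)).1
    have : 0 ≤ (1 - orbit p 0) * ℓ (orbit p (0 + 1)) := mul_nonneg (by linarith [(hm 0).2]) this
    linarith
  refine sigmaStarOptimal_of_certificate hp hℓ (ε := fun k => decide (orbit p k ≤ 1 / 3))
    (u := fun k => tangent (ℓ (orbit p k)) (e (orbit p k)) (orbit p k) (1 - p))
    (w := fun k => tangent (ℓ (orbit p k)) (e (orbit p k)) (orbit p k) p)
    ?_ hpos ?_ ?_ ?_ ?_ hu1 hw1 ?_
  · simp [tangent, orbit_zero]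
  · intro k
    rw [hstep k, hrec k]
    rcases le_or_gt (orbit p k) (1 / 3) with hk | hk
    · rw [tangent_step_of_le hp hk, ← orbit_succ]
      simp only [continuation, hk, decide_true, if_true]
      ring
    · rw [tangent_step_of_gt hp hk (by linarith [(hm k).2]), ← orbit_succ]
      simp only [continuation, hk.not_ge, decide_false, Bool.false_eq_true, if_false]
      ring
  · intro k
    rw [hstep k, hrec k]
    rcases le_or_gt (orbit p k) (1 / 3) with hk | hk
    · rw [tangent_step_of_le hp hk, ← orbit_succ]
      simp only [continuation, hk, decide_true, if_true]
      ring
    · rw [tangent_step_of_gt hp hk (by linarith [(hm k).2]), ← orbit_succ]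
      simp only [continuation, hk.not_ge, decide_false, Bool.false_eq_true, if_false]
      ring
  · intro k; linarith [hwu k, hu2 k]
  · intro k; linarith [hwu k, hu2 k]
  · intro k
    rw [abs_le]
    constructor <;> linarith [hwu k, hu2 k, hu1 k, hu2 0, hw2 k, hwu 0]

/-! ### Lipschitz bounds and the homogeneous extension of the reveal time. -/

theorem abs_foldBelief_sub_le (a b : ℝ) : |foldBelief a - foldBelief b| ≤ |a - b| := by
  unfold foldBelief
  refine (abs_min_sub_min_le_max _ _ _ _).trans (max_le le_rfl ?_)
  rw [show 1 - a - (1 - b) = -(a - b) by ring, abs_neg]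

theorem abs_foldMap_sub_le {p x y : ℝ} (hp : 1 / 2 ≤ p) (hx : x ≤ 1 / 2) (hy : y ≤ 1 / 2) :
    (1 - x) * |foldMap p x - foldMap p y| ≤ 2 * (2 * p - 1) * |x - y| := by
  have h1 : 0 < 1 - x := by linarith
  have h2 : 0 < 1 - y := by linarith
  have e : (1 - p + (2 * p - 1) * (x / (1 - x))) - (1 - p + (2 * p - 1) * (y / (1 - y))) =
      (2 * p - 1) / ((1 - x) * (1 - y)) * (x - y) := by
    field_simp
    ring
  have h := abs_foldBelief_sub_le (1 - p + (2 * p - 1) * (x / (1 - x)))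
    (1 - p + (2 * p - 1) * (y / (1 - y)))
  have h0 : 0 ≤ (2 * p - 1) / ((1 - x) * (1 - y)) := div_nonneg (by linarith) (by positivity)
  rw [e, abs_mul, abs_of_nonneg h0] at h
  have h3 := mul_le_mul_of_nonneg_left h h1.le
  refine h3.trans ?_
  have e2 : (1 - x) * ((2 * p - 1) / ((1 - x) * (1 - y)) * |x - y|) =
      (2 * p - 1) / (1 - y) * |x - y| := by
    field_simp
  rw [e2]
  refine mul_le_mul_of_nonneg_right ?_ (abs_nonneg _)
  rw [div_le_iff₀ h2]
  nlinarith

/-- The factor 1 - x in the recursion cancels one denominator in the increment of the odds, so a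
Lipschitz constant Λ becomes at most 1 / (1 - p) + 2(2p - 1) Λ; `hΛ` asks that Λ survive this. -/
theorem abs_timeIter_sub_timeIter_le {p Λ : ℝ} (hp : 1 / 2 ≤ p) (hp1 : p < 1) (hΛ0 : 0 ≤ Λ)
    (hΛ : 1 / (1 - p) + 2 * (2 * p - 1) * Λ ≤ Λ) (n : ℕ) {x y : ℝ}
    (hx : x ∈ Set.Icc (1 - p) (1 / 2)) (hy : y ∈ Set.Icc (1 - p) (1 / 2)) :
    |timeIter p n x - timeIter p n y| ≤ Λ * |x - y| := by
  induction n generalizing x y with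
  | zero => simp only [timeIter, sub_self, abs_zero]; positivity
  | succ n ih =>
    have hm := foldMap_mem hp (by linarith [hx.1]) hx.2
    have hm' := foldMap_mem hp (by linarith [hy.1]) hy.2
    have h1 := ih hm hm'
    have h2 := timeIter_mem hp hp1 n hm'
    have h3 := abs_foldMap_sub_le hp hx.2 hy.2
    have h0 : 0 < 1 - x := by linarith [hx.2]
    have e : timeIter p (n + 1) x - timeIter p (n + 1) y =
        (1 - x) * (timeIter p n (foldMap p x) - timeIter p n (foldMap p y)) -
          (x - y) * timeIter p n (foldMap p y) := by
      simp only [timeIter]; ring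
    rw [e]
    calc _ ≤ (1 - x) * |timeIter p n (foldMap p x) - timeIter p n (foldMap p y)| +
          |x - y| * timeIter p n (foldMap p y) := by
          refine (abs_sub _ _).trans ?_
          rw [abs_mul, abs_mul, abs_of_pos h0, abs_of_nonneg h2.1]
      _ ≤ (1 - x) * (Λ * |foldMap p x - foldMap p y|) + |x - y| * (1 / (1 - p)) := by
          refine add_le_add (mul_le_mul_of_nonneg_left h1 h0.le)
            (mul_le_mul_of_nonneg_left h2.2 (abs_nonneg _))
      _ ≤ Λ * (2 * (2 * p - 1) * |x - y|) + |x - y| * (1 / (1 - p)) := by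
          have := mul_le_mul_of_nonneg_left h3 hΛ0
          linarith
      _ ≤ Λ * |x - y| := by
          have := mul_le_mul_of_nonneg_right hΛ (abs_nonneg (x - y))
          linarith

/-- Homogeneous extension of the expected reveal time to measures on the states. -/
noncomputable def massTime (ℓ : ℝ → ℝ) (X Y : ℝ) : ℝ := (X + Y) * ℓ (X / (X + Y))

/-- The measures on the states whose belief lies in the invariant interval. -/
def InCone (p X Y : ℝ) : Prop := 0 < X + Y ∧ X / (X + Y) ∈ Set.Icc (1 - p) (1 / 2)

/-- On measures the recursion is linear on each of the two cones separated by 2X = Y. Homogeneity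
allows a free factor N, used later to keep all coordinates integral. -/
theorem massTime_of_le {p : ℝ} (hp : 1 / 2 ≤ p) (hp1 : p ≤ 1) {ℓ : ℝ → ℝ}
    (hℓ : IsRevealTime p ℓ) {X Y : ℝ} (hc : InCone p X Y) (h : 2 * X ≤ Y) {N : ℝ} (hN : 0 < N) :
    InCone p (N * ((2 * p - 1) * X + (1 - p) * Y)) (N * (p * Y - (2 * p - 1) * X)) ∧
      massTime ℓ X Y = X + Y + 1 / N *
        massTime ℓ (N * ((2 * p - 1) * X + (1 - p) * Y)) (N * (p * Y - (2 * p - 1) * X)) := by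
  obtain ⟨hS, hx⟩ := hc
  obtain ⟨-, h1, h2⟩ := odds_step_of_le hp hx hS (div_mul_cancel₀ _ hS.ne') h
  have e : N * ((2 * p - 1) * X + (1 - p) * Y) / (N * ((2 * p - 1) * X + (1 - p) * Y) +
      N * (p * Y - (2 * p - 1) * X)) = foldMap p (X / (X + Y)) := by
    rw [← mul_add, mul_div_mul_left _ _ hN.ne', div_eq_iff h1.ne', h2]
  refine ⟨⟨by rw [← mul_add]; positivity, ?_⟩, ?_⟩
  · rw [e]
    exact foldMap_mem hp (le_trans (by linarith) hx.1) hx.2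
  · unfold massTime
    rw [e, hℓ.1 _ hx]
    field_simp
    ring

theorem massTime_of_gt {p : ℝ} (hp : 1 / 2 ≤ p) (hp1 : p ≤ 1) {ℓ : ℝ → ℝ}
    (hℓ : IsRevealTime p ℓ) {X Y : ℝ} (hc : InCone p X Y) (h : Y < 2 * X) {N : ℝ} (hN : 0 < N) :
    InCone p (N * (p * Y - (2 * p - 1) * X)) (N * ((2 * p - 1) * X + (1 - p) * Y)) ∧
      massTime ℓ X Y = X + Y + 1 / N *
        massTime ℓ (N * (p * Y - (2 * p - 1) * X)) (N * ((2 * p - 1) * X + (1 - p) * Y)) := by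
  obtain ⟨hS, hx⟩ := hc
  obtain ⟨-, h1, h2⟩ := odds_step_of_gt hp hx hS (div_mul_cancel₀ _ hS.ne') h
  have e : N * (p * Y - (2 * p - 1) * X) / (N * (p * Y - (2 * p - 1) * X) +
      N * ((2 * p - 1) * X + (1 - p) * Y)) = foldMap p (X / (X + Y)) := by
    rw [← mul_add, mul_div_mul_left _ _ hN.ne', div_eq_iff h1.ne', h2]
  refine ⟨⟨by rw [← mul_add]; positivity, ?_⟩, ?_⟩
  · rw [e]
    exact foldMap_mem hp (le_trans (by linarith) hx.1) hx.2
  · unfold massTime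
    rw [e, hℓ.1 _ hx]
    field_simp
    ring

theorem abs_massTime_sub_le {p Λ : ℝ} {ℓ : ℝ → ℝ} (hp : 0 ≤ 1 - p)
    (hb : ∀ x ∈ Set.Icc (1 - p) (1 / 2), |ℓ x| ≤ Λ)
    (hL : ∀ x ∈ Set.Icc (1 - p) (1 / 2), ∀ y ∈ Set.Icc (1 - p) (1 / 2),
      |ℓ x - ℓ y| ≤ Λ * |x - y|) {X Y X' Y' : ℝ}
    (h : InCone p X Y) (h' : InCone p X' Y') :
    |massTime ℓ X Y - massTime ℓ X' Y'| ≤ 3 * Λ * (|X - X'| + |Y - Y'|) := by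
  obtain ⟨hS, hx⟩ := h
  obtain ⟨hS', hx'⟩ := h'
  have hΛ : 0 ≤ Λ := (abs_nonneg _).trans (hb _ hx)
  have e : massTime ℓ X Y - massTime ℓ X' Y' = (X + Y) * (ℓ (X / (X + Y)) - ℓ (X' / (X' + Y'))) +
      ((X - X') + (Y - Y')) * ℓ (X' / (X' + Y')) := by
    unfold massTime; ring
  have e2 : (X + Y) * (X / (X + Y) - X' / (X' + Y')) =
      (X - X') - ((X - X') + (Y - Y')) * (X' / (X' + Y')) := by
    field_simp
    ring
  have hx0 : |X' / (X' + Y')| ≤ 1 := by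
    rw [abs_le]; constructor <;> linarith [hx'.1, hx'.2]
  have h1 : |(X + Y) * (X / (X + Y) - X' / (X' + Y'))| ≤ |X - X'| + (|X - X'| + |Y - Y'|) := by
    rw [e2]
    refine (abs_sub _ _).trans (add_le_add le_rfl ?_)
    rw [abs_mul]
    calc _ ≤ |X - X' + (Y - Y')| * 1 := mul_le_mul_of_nonneg_left hx0 (abs_nonneg _)
      _ ≤ _ := by rw [mul_one]; exact abs_add_le _ _
  have h2 : |(X + Y) * (ℓ (X / (X + Y)) - ℓ (X' / (X' + Y')))| ≤
      Λ * (|X - X'| + (|X - X'| + |Y - Y'|)) := by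
    refine le_trans ?_ (mul_le_mul_of_nonneg_left h1 hΛ)
    rw [abs_mul, abs_mul, abs_of_pos hS]
    have := mul_le_mul_of_nonneg_left (hL _ hx _ hx') hS.le
    linarith
  have h3 : |((X - X') + (Y - Y')) * ℓ (X' / (X' + Y'))| ≤ (|X - X'| + |Y - Y'|) * Λ := by
    rw [abs_mul]
    exact mul_le_mul (abs_add_le _ _) (hb _ hx') (abs_nonneg _) (by positivity)
  rw [e]
  refine (abs_add_le _ _).trans ?_
  have := mul_nonneg hΛ (abs_nonneg (Y - Y'))
  linarith

/-! ### Integer bounds at p = 0.73275300915. -/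

/-- The parameter of the counterexample is `numP / scale`. -/
def scale : ℤ := 100000000000

/-- Numerator of `p`. -/
def numP : ℤ := 73275300915

/-- Numerator of `1 - p`. -/
def numQ : ℤ := 26724699085

/-- Numerator of `2 * p - 1`. -/
def numC : ℤ := 46550601830

/-- The measure after a non-revealing move, before folding. -/
def stepFst (X Y : ℤ) : ℤ := numC * X + numQ * Y

/-- The measure after a non-revealing move, before folding. -/
def stepSnd (X Y : ℤ) : ℤ := numP * Y - numC * X

/-- A scaled lower bound for minus the derivative of `massTime` at `(X, Y)` in the direction
`-(a, b)`. -/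
def slopeBound : ℕ → ℤ → ℤ → ℤ → ℤ → ℤ
  | 0, _, _, a, b => -(165 * (|a| + |b|))
  | n + 1, X, Y, a, b =>
    if 2 * X < Y then
      (a + b) * scale ^ (n + 1) +
        slopeBound n (stepFst X Y) (stepSnd X Y) (stepFst a b) (stepSnd a b)
    else if Y < 2 * X then
      (a + b) * scale ^ (n + 1) +
        slopeBound n (stepSnd X Y) (stepFst X Y) (stepSnd a b) (stepFst a b)
    else -(165 * (|a| + |b|)) * scale ^ (n + 1)

/-- A scaled upper bound for `massTime`. -/
def timeBound : ℕ → ℤ → ℤ → ℤ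
  | 0, X, Y => (X + Y) * 4
  | n + 1, X, Y =>
    if 2 * X ≤ Y then (X + Y) * scale ^ (n + 1) + timeBound n (stepFst X Y) (stepSnd X Y)
    else (X + Y) * scale ^ (n + 1) + timeBound n (stepSnd X Y) (stepFst X Y)

/-- The `n`-th iterate of the folded non-revealing move on measures. -/
def measureOrbit : ℕ → ℤ → ℤ → ℤ × ℤ
  | 0, X, Y => (X, Y)
  | n + 1, X, Y =>
    if 2 * X ≤ Y then measureOrbit n (stepFst X Y) (stepSnd X Y)
    else measureOrbit n (stepSnd X Y) (stepFst X Y)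

/-- The numerical core of the counterexample: up to powers of `scale`, this is ℓ(1 - p) < (2p - 1)(K
+ K'), with ℓ bounded above and the two rates of decrease bounded below by unrolling the recursion
60 times. -/
theorem timeBound_lt_slopeBound : timeBound 60 numQ numP <
    numC * (slopeBound 60 numQ numP (-1) 1 +
      slopeBound 60 (measureOrbit 58 numQ numP).1 (measureOrbit 58 numQ numP).2 (-1) 1) := by
  decide +kernel

theorem measureOrbit_57 : (measureOrbit 57 numQ numP).2 < 2 * (measureOrbit 57 numQ numP).1 ∧
    (measureOrbit 57 numQ numP).1 < (measureOrbit 57 numQ numP).2 := by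
  decide +kernel

/-- The parameter for which `σ*` is not optimal. -/
noncomputable def badParam : ℝ := 0.73275300915

theorem cast_stepFst (X Y : ℤ) : (stepFst X Y : ℝ) =
    (scale : ℝ) * ((2 * badParam - 1) * X + (1 - badParam) * Y) := by
  simp only [stepFst, badParam, numC, numQ, scale]
  push_cast
  ring

theorem cast_stepSnd (X Y : ℤ) : (stepSnd X Y : ℝ) =
    (scale : ℝ) * (badParam * Y - (2 * badParam - 1) * X) := by
  simp only [stepSnd, badParam, numC, numP, scale]
  push_cast
  ring

theorem scale_pos : (0 : ℝ) < (scale : ℝ) := by norm_num [scale]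

theorem half_le_badParam : 1 / 2 ≤ badParam := by norm_num [badParam]

theorem badParam_lt_one : badParam < 1 := by norm_num [badParam]

theorem massTime_le_timeBound {ℓ : ℝ → ℝ} (hℓ : IsRevealTime badParam ℓ)
    (hb : ∀ x ∈ Set.Icc (1 - badParam) (1 / 2), |ℓ x| ≤ 4) (n : ℕ) {X Y : ℤ}
    (h : InCone badParam X Y) :
    massTime ℓ X Y * (scale : ℝ) ^ n ≤ timeBound n X Y := by
  induction n generalizing X Y with
  | zero =>
    simp only [timeBound, massTime, pow_zero, mul_one]
    push_cast
    exact mul_le_mul_of_nonneg_left (abs_le.1 (hb _ h.2)).2 h.1.le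
  | succ n ih =>
    have hs := scale_pos
    simp only [timeBound]
    split_ifs with hX
    · obtain ⟨h1, h2⟩ := massTime_of_le half_le_badParam badParam_lt_one.le hℓ h
        (by exact_mod_cast hX) hs
      rw [← cast_stepFst, ← cast_stepSnd] at h1 h2
      have := ih h1
      rw [h2]
      push_cast
      have e : (scale : ℝ) ^ (n + 1) * (1 / (scale : ℝ)) = (scale : ℝ) ^ n := by
        field_simp
        ring
      linear_combination this + massTime ℓ (stepFst X Y) (stepSnd X Y) * e
    · push Not at hX
      obtain ⟨h1, h2⟩ := massTime_of_gt half_le_badParam badParam_lt_one.le hℓ h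
        (by exact_mod_cast hX) hs
      rw [← cast_stepFst, ← cast_stepSnd] at h1 h2
      have := ih h1
      rw [h2]
      push_cast
      have e : (scale : ℝ) ^ (n + 1) * (1 / (scale : ℝ)) = (scale : ℝ) ^ n := by
        field_simp
        ring
      linear_combination this + massTime ℓ (stepSnd X Y) (stepFst X Y) * e

theorem measureOrbit_spec (n : ℕ) {X Y : ℤ} (h : InCone badParam X Y) :
    InCone badParam (measureOrbit n X Y).1 (measureOrbit n X Y).2 ∧
      ((measureOrbit n X Y).1 : ℝ) / ((measureOrbit n X Y).1 + (measureOrbit n X Y).2) =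
        (foldMap badParam)^[n] (X / (X + Y)) := by
  induction n generalizing X Y with
  | zero => exact ⟨h, rfl⟩
  | succ n ih =>
    have hs := scale_pos
    have hp := half_le_badParam
    simp only [measureOrbit, Function.iterate_succ, Function.comp_apply]
    have hm := foldMap_mem hp (le_trans (by linarith [badParam_lt_one]) h.2.1) h.2.2
    split_ifs with hX
    · obtain ⟨-, h1, h2⟩ := odds_step_of_le hp h.2 h.1 (div_mul_cancel₀ _ h.1.ne')
        (by exact_mod_cast hX)
      have e : (stepFst X Y : ℝ) / (stepFst X Y + stepSnd X Y) =
          foldMap badParam (X / (X + Y)) := by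
        rw [cast_stepFst, cast_stepSnd, ← mul_add, mul_div_mul_left _ _ hs.ne',
          div_eq_iff h1.ne', h2]
      rw [← e] at hm ⊢
      exact ih ⟨by rw [cast_stepFst, cast_stepSnd, ← mul_add]; positivity, hm⟩
    · push Not at hX
      obtain ⟨-, h1, h2⟩ := odds_step_of_gt hp h.2 h.1 (div_mul_cancel₀ _ h.1.ne')
        (by exact_mod_cast hX)
      have e : (stepSnd X Y : ℝ) / (stepSnd X Y + stepFst X Y) =
          foldMap badParam (X / (X + Y)) := by
        rw [cast_stepFst, cast_stepSnd, ← mul_add, mul_div_mul_left _ _ hs.ne',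
          div_eq_iff h1.ne', h2]
      rw [← e] at hm ⊢
      exact ih ⟨by rw [cast_stepFst, cast_stepSnd, ← mul_add]; positivity, hm⟩

/-! ### One-sided slopes of the reveal time. -/

theorem eventually_lt_of_linear {u v a b : ℝ} (h : u < v) :
    ∀ᶠ δ in nhdsWithin (0 : ℝ) (Set.Ioi 0), u - δ * a < v - δ * b := by
  have h1 : Tendsto (fun δ : ℝ => u - δ * a) (nhdsWithin 0 (Set.Ioi 0)) (nhds u) :=
    (Continuous.tendsto' (by fun_prop) 0 u (by simp)).mono_left nhdsWithin_le_nhds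
  have h2 : Tendsto (fun δ : ℝ => v - δ * b) (nhdsWithin 0 (Set.Ioi 0)) (nhds v) :=
    (Continuous.tendsto' (by fun_prop) 0 v (by simp)).mono_left nhdsWithin_le_nhds
  exact h1.eventually_lt h2 h

theorem slope_step {V : ℝ → ℝ → ℝ} {s X Y X' Y' a b a' b' K : ℝ} (hs : 0 < s) (n : ℕ)
    (e : V X Y = X + Y + 1 / s * V X' Y')
    (h : ∀ᶠ δ in nhdsWithin (0 : ℝ) (Set.Ioi 0), V (X - δ * a) (Y - δ * b) =
      (X - δ * a) + (Y - δ * b) + 1 / s * V (X' - δ * a') (Y' - δ * b'))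
    (hK : ∀ᶠ δ in nhdsWithin (0 : ℝ) (Set.Ioi 0),
      δ * K ≤ (V X' Y' - V (X' - δ * a') (Y' - δ * b')) * s ^ n) :
    ∀ᶠ δ in nhdsWithin (0 : ℝ) (Set.Ioi 0), δ * ((a + b) * s ^ (n + 1) + K) ≤
      (V X Y - V (X - δ * a) (Y - δ * b)) * s ^ (n + 1) := by
  filter_upwards [h, hK] with δ h1 h2
  rw [e, h1]
  have : s ^ (n + 1) * (1 / s) = s ^ n := by
    field_simp
    ring
  linear_combination h2 - (V X' Y' - V (X' - δ * a') (Y' - δ * b')) * this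

/-- Strictly on one side of 2X = Y, nearby measures take the same branch and their differences
propagate linearly. On the line itself, or once the n steps are used up, the Lipschitz bound of
`abs_massTime_sub_le` takes over, with 165 = 3 · 55. -/
theorem slopeBound_le {ℓ : ℝ → ℝ} (hℓ : IsRevealTime badParam ℓ)
    (hb : ∀ x ∈ Set.Icc (1 - badParam) (1 / 2), |ℓ x| ≤ 55)
    (hL : ∀ x ∈ Set.Icc (1 - badParam) (1 / 2), ∀ y ∈ Set.Icc (1 - badParam) (1 / 2),
      |ℓ x - ℓ y| ≤ 55 * |x - y|) (n : ℕ) {X Y a b : ℤ} (h : InCone badParam X Y)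
    (h' : ∀ᶠ δ in nhdsWithin (0 : ℝ) (Set.Ioi 0), InCone badParam (X - δ * a) (Y - δ * b)) :
    ∀ᶠ δ in nhdsWithin (0 : ℝ) (Set.Ioi 0), δ * slopeBound n X Y a b ≤
      (massTime ℓ X Y - massTime ℓ (X - δ * a) (Y - δ * b)) * (scale : ℝ) ^ n := by
  have base : ∀ {X Y a b : ℤ}, InCone badParam X Y →
      (∀ᶠ δ in nhdsWithin (0 : ℝ) (Set.Ioi 0), InCone badParam (X - δ * a) (Y - δ * b)) →
      ∀ᶠ δ in nhdsWithin (0 : ℝ) (Set.Ioi 0), δ * (-(165 * (|(a : ℝ)| + |(b : ℝ)|))) ≤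
        massTime ℓ X Y - massTime ℓ (X - δ * a) (Y - δ * b) := by
    intro X Y a b h h'
    filter_upwards [h', self_mem_nhdsWithin] with δ hδ hpos
    have hpos : 0 < δ := hpos
    have := (abs_le.1 (abs_massTime_sub_le (by linarith [badParam_lt_one]) hb hL h hδ)).1
    rw [sub_sub_cancel, sub_sub_cancel, abs_mul, abs_mul, abs_of_pos hpos] at this
    linarith
  have hs := scale_pos
  have hp := half_le_badParam
  have hp1 := badParam_lt_one.le
  induction n generalizing X Y a b with
  | zero =>
    filter_upwards [base h h'] with δ hδ
    simp only [slopeBound]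
    push_cast
    linarith
  | succ n ih =>
    simp only [slopeBound]
    split_ifs with h1 h2
    · have h1' : 2 * (X : ℝ) < Y := by exact_mod_cast h1
      obtain ⟨c1, e1⟩ := massTime_of_le hp hp1 hℓ h h1'.le hs
      rw [← cast_stepFst, ← cast_stepSnd] at c1 e1
      have hstep : ∀ᶠ δ in nhdsWithin (0 : ℝ) (Set.Ioi 0),
          InCone badParam (stepFst X Y - δ * stepFst a b) (stepSnd X Y - δ * stepSnd a b) ∧
          massTime ℓ (X - δ * a) (Y - δ * b) = (X - δ * a) + (Y - δ * b) + 1 / (scale : ℝ) *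
            massTime ℓ (stepFst X Y - δ * stepFst a b) (stepSnd X Y - δ * stepSnd a b) := by
        filter_upwards [h', eventually_lt_of_linear (a := 2 * a) (b := b) h1'] with δ hδ hlt
        have := massTime_of_le hp hp1 hℓ hδ (by linarith) hs
        simp only [cast_stepFst, cast_stepSnd]
        convert this using 3 <;> ring_nf
      have := slope_step hs n e1 (hstep.mono fun δ hδ => hδ.2)
        (ih c1 (hstep.mono fun δ hδ => hδ.1))
      push_cast
      exact this
    · have h2' : (Y : ℝ) < 2 * X := by exact_mod_cast h2
      obtain ⟨c1, e1⟩ := massTime_of_gt hp hp1 hℓ h h2' hs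
      rw [← cast_stepFst, ← cast_stepSnd] at c1 e1
      have hstep : ∀ᶠ δ in nhdsWithin (0 : ℝ) (Set.Ioi 0),
          InCone badParam (stepSnd X Y - δ * stepSnd a b) (stepFst X Y - δ * stepFst a b) ∧
          massTime ℓ (X - δ * a) (Y - δ * b) = (X - δ * a) + (Y - δ * b) + 1 / (scale : ℝ) *
            massTime ℓ (stepSnd X Y - δ * stepSnd a b) (stepFst X Y - δ * stepFst a b) := by
        filter_upwards [h', eventually_lt_of_linear (a := b) (b := 2 * a) h2'] with δ hδ hlt
        have := massTime_of_gt hp hp1 hℓ hδ (by linarith) hs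
        simp only [cast_stepFst, cast_stepSnd]
        convert this using 3 <;> ring_nf
      have := slope_step hs n e1 (hstep.mono fun δ hδ => hδ.2)
        (ih c1 (hstep.mono fun δ hδ => hδ.1))
      push_cast
      exact this
    · filter_upwards [base h h'] with δ hδ
      have := mul_le_mul_of_nonneg_right hδ (show 0 ≤ (scale : ℝ) ^ (n + 1) by positivity)
      push_cast
      linarith

/-- `ℓ` decreases to the right of `x` at rate at least `K`. -/
def HasRightDecrease (ℓ : ℝ → ℝ) (x K : ℝ) : Prop :=
  ∀ᶠ δ in nhdsWithin (0 : ℝ) (Set.Ioi 0), δ * K ≤ ℓ x - ℓ (x + δ)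

/-- Subtracting δ(-1, 1) keeps the total mass and moves the belief to the right; rescaling δ by X +
Y turns the increment of the measure into that of the belief. -/
theorem hasRightDecrease_slopeBound {ℓ : ℝ → ℝ} (hℓ : IsRevealTime badParam ℓ)
    (hb : ∀ x ∈ Set.Icc (1 - badParam) (1 / 2), |ℓ x| ≤ 55)
    (hL : ∀ x ∈ Set.Icc (1 - badParam) (1 / 2), ∀ y ∈ Set.Icc (1 - badParam) (1 / 2),
      |ℓ x - ℓ y| ≤ 55 * |x - y|) (n : ℕ) {X Y : ℤ} (h : InCone badParam X Y) (hXY : X < Y) :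
    HasRightDecrease ℓ ((X : ℝ) / (X + Y)) (slopeBound n X Y (-1) 1 / (scale : ℝ) ^ n) := by
  have hS := h.1
  have hs := scale_pos
  have hXY' : (X : ℝ) < Y := by exact_mod_cast hXY
  have hd : ∀ δ : ℝ, (X - δ * ((-1 : ℤ) : ℝ)) + (Y - δ * ((1 : ℤ) : ℝ)) = X + Y := fun δ => by
    push_cast; ring
  have hq : ∀ δ : ℝ, (X - δ * ((-1 : ℤ) : ℝ)) / (X + Y) = X / (X + Y) + δ / (X + Y) := fun δ => by
    push_cast; ring
  have h' : ∀ᶠ δ in nhdsWithin (0 : ℝ) (Set.Ioi 0),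
      InCone badParam (X - δ * ((-1 : ℤ) : ℝ)) (Y - δ * ((1 : ℤ) : ℝ)) := by
    filter_upwards [eventually_lt_of_linear (a := -1) (b := 1) hXY', self_mem_nhdsWithin]
      with δ h1 h2
    have h2 : 0 < δ := h2
    refine ⟨by rw [hd]; exact hS, ?_, ?_⟩
    · rw [hd, hq]
      have : 0 < δ / (X + Y) := by positivity
      linarith [h.2.1]
    · rw [hd, div_le_iff₀ hS]
      push_cast
      linarith
  have key := slopeBound_le hℓ hb hL n h h'
  have hmul : Tendsto (fun δ : ℝ => (X + Y) * δ) (nhdsWithin 0 (Set.Ioi 0))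
      (nhdsWithin 0 (Set.Ioi 0)) := by
    refine tendsto_nhdsWithin_iff.2 ⟨(Continuous.tendsto' (by fun_prop) 0 0 (by simp)).mono_left
      nhdsWithin_le_nhds, ?_⟩
    filter_upwards [self_mem_nhdsWithin] with δ hδ
    exact mul_pos hS hδ
  filter_upwards [hmul.eventually key] with δ hδ
  unfold massTime at hδ
  rw [hd, hq, mul_div_cancel_left₀ _ hS.ne', ← mul_sub, mul_assoc, mul_assoc] at hδ
  have := le_of_mul_le_mul_left hδ hS
  rw [← mul_div_assoc, div_le_iff₀ (by positivity)]
  exact this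

/-- If the orbit hit 1/2 exactly, the next point would be F(1/2) = 1 - p. With K' = K the required
inequality says that the line of slope -K through the graph of ℓ at 1 - p violates the bound u ≤ 2w,
on which optimality rests for smaller p. Here x lies below 1/2, so the two rates are bounded
separately. -/
theorem exists_steep_revealTime : ∃ (ℓ : ℝ → ℝ) (K K' : ℝ), IsRevealTime badParam ℓ ∧
    0 < ℓ (1 - badParam) ∧ HasRightDecrease ℓ (1 - badParam) K ∧
    HasRightDecrease ℓ (foldMap badParam (orbit badParam 57)) K' ∧
    ℓ (1 - badParam) < (2 * badParam - 1) * (K + K') ∧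
    1 / 3 < orbit badParam 57 ∧ orbit badParam 57 < 1 / 2 := by
  have hp := half_le_badParam
  have hp1 := badParam_lt_one
  have hs := scale_pos
  obtain ⟨ℓ, hℓ, h⟩ := exists_revealTime hp hp1
  have h4 : 1 / (1 - badParam) ≤ 4 := by norm_num [badParam]
  have hb : ∀ x ∈ Set.Icc (1 - badParam) (1 / 2), |ℓ x| ≤ 4 := fun x hx => by
    rw [abs_of_nonneg (h x hx).1]
    exact (h x hx).2.1.trans h4
  -- The Lipschitz condition holds for 55: 1 / (1 - p) is about 3.742 and 2(2p - 1) about 0.931, so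
  -- Λ must be at least about 54.3.
  have hL : ∀ x ∈ Set.Icc (1 - badParam) (1 / 2), ∀ y ∈ Set.Icc (1 - badParam) (1 / 2),
      |ℓ x - ℓ y| ≤ 55 * |x - y| := fun x hx y hy =>
    le_of_tendsto' ((h x hx).2.2.sub (h y hy).2.2).abs fun n =>
      abs_timeIter_sub_timeIter_le hp hp1 (by norm_num) (by norm_num [badParam]) n hx hy
  have hsum : (numQ : ℝ) + numP = scale := by norm_num [numQ, numP, scale]
  have hq : (numQ : ℝ) / (numQ + numP) = 1 - badParam := by
    norm_num [numQ, numP, badParam]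
  have hc : InCone badParam numQ numP := by
    refine ⟨by rw [hsum]; exact hs, ?_⟩
    rw [hq]
    exact ⟨le_rfl, by linarith⟩
  obtain ⟨c57, e57⟩ := measureOrbit_spec 57 hc
  obtain ⟨c58, e58⟩ := measureOrbit_spec 58 hc
  rw [hq] at e57 e58
  have e58' : foldMap badParam (orbit badParam 57) = (measureOrbit 58 numQ numP).1 /
      ((measureOrbit 58 numQ numP).1 + (measureOrbit 58 numQ numP).2) := by
    rw [e58, ← orbit_succ]; rfl
  have k0 := hasRightDecrease_slopeBound hℓ (fun x hx => (hb x hx).trans (by norm_num)) hL 60 hc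
    (by decide)
  have k1 := hasRightDecrease_slopeBound hℓ (fun x hx => (hb x hx).trans (by norm_num)) hL 60 c58
    (by decide +kernel)
  rw [hq] at k0
  rw [← e58'] at k1
  have hq' : 1 - badParam ∈ Set.Icc (1 - badParam) (1 / 2) := ⟨le_rfl, by linarith⟩
  refine ⟨ℓ, _, _, hℓ, ?_, k0, k1, ?_, ?_, ?_⟩
  · rw [hℓ.1 _ hq']
    have := (h _ (foldMap_mem hp (by linarith [hq'.1]) hq'.2)).1
    have : 0 ≤ (1 - (1 - badParam)) * ℓ (foldMap badParam (1 - badParam)) :=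
      mul_nonneg (by linarith) this
    linarith
  · have ht := massTime_le_timeBound hℓ hb 60 hc
    unfold massTime at ht
    rw [hq, hsum] at ht
    have hlt : (timeBound 60 numQ numP : ℝ) < numC * (slopeBound 60 numQ numP (-1) 1 +
        slopeBound 60 (measureOrbit 58 numQ numP).1 (measureOrbit 58 numQ numP).2 (-1) 1) := by
      exact_mod_cast timeBound_lt_slopeBound
    have hC : 2 * badParam - 1 = numC / scale := by norm_num [badParam, numC, scale]
    rw [hC, ← add_div, div_mul_div_comm, lt_div_iff₀ (by positivity)]
    linarith
  · rw [show orbit badParam 57 = _ from e57.symm, lt_div_iff₀ c57.1]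
    have : ((measureOrbit 57 numQ numP).2 : ℝ) < 2 * (measureOrbit 57 numQ numP).1 := by
      exact_mod_cast measureOrbit_57.1
    linarith
  · rw [show orbit badParam 57 = _ from e57.symm, div_lt_iff₀ c57.1]
    have : ((measureOrbit 57 numQ numP).1 : ℝ) < (measureOrbit 57 numQ numP).2 := by
      exact_mod_cast measureOrbit_57.2
    linarith

/-! ### The modified strategy, which reveals less at one folded belief. -/

/-- Projection of a real number to the unit interval. -/
noncomputable def toUnit (r : ℝ) : unitInterval := Set.projIcc 0 1 zero_le_one r

theorem coe_toUnit {r : ℝ} (h0 : 0 ≤ r) (h1 : r ≤ 1) : (toUnit r : ℝ) = r := by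
  rw [toUnit, Set.projIcc_of_mem zero_le_one ⟨h0, h1⟩]

/-- The modification of `σ*` that reveals less at the beliefs `x` and `1 - x`. -/
noncomputable def devPlay (x η : ℝ) (θ : unitInterval) (s : State) : unitInterval :=
  if (θ : ℝ) = x then
    match s with
    | State.low => toUnit ((x - η) / x)
    | State.high => toUnit ((1 - 2 * x + η) / (1 - x))
  else if (θ : ℝ) = 1 - x then
    match s with
    | State.low => toUnit ((x - η) / (1 - x))
    | State.high => toUnit (η / x)
  else starPlay θ s

/-- Folded belief after a less revealing move of the modified strategy. -/
noncomputable def devFar (p x η : ℝ) : ℝ := 1 - p + (2 * p - 1) * ((1 - 2 * x + η) / (1 - x))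

/-- Folded belief after a more revealing move of the modified strategy. -/
noncomputable def devNear (p x η : ℝ) : ℝ := 1 - p + (2 * p - 1) * (η / x)

/-- The belief update of the modified strategy. -/
noncomputable def devUpdate (p : unitInterval) (x η : ℝ) (θ : unitInterval) (a : Move1) :
    unitInterval :=
  if (θ : ℝ) = x then
    match a with
    | Move1.T => toUnit (1 - devFar p x η)
    | Move1.B => toUnit (devNear p x η)
  else if (θ : ℝ) = 1 - x then
    match a with
    | Move1.T => toUnit (1 - devNear p x η)
    | Move1.B => toUnit (devFar p x η)
  else starUpdate p θ a

open Classical in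
/-- The gain in one stage of the modified strategy. -/
noncomputable def devGain (x η : ℝ) (θ : unitInterval) : ℝ :=
  if (θ : ℝ) = x ∨ (θ : ℝ) = 1 - x then x - η else foldBelief θ

/-- The admissible parameters of the modified strategy. -/
structure DevAdmissible (p x η : ℝ) : Prop where
  half_le : 1 / 2 ≤ p
  le_one : p ≤ 1
  pos : 0 < η
  le : η ≤ x
  lt_half : x < 1 / 2
  far_le : devFar p x η ≤ 1 / 2
  near_le : devNear p x η ≤ 1 / 2

namespace DevAdmissible

variable {p : unitInterval} {x η : ℝ}

theorem one_sub_le_far (h : DevAdmissible p x η) : 1 - (p : ℝ) ≤ devFar p x η := by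
  have := h.lt_half
  have := h.pos
  have := h.half_le
  have : 0 ≤ (1 - 2 * x + η) / (1 - x) := div_nonneg (by linarith) (by linarith)
  unfold devFar
  nlinarith

theorem one_sub_le_near (h : DevAdmissible p x η) : 1 - (p : ℝ) ≤ devNear p x η := by
  have := h.pos
  have := h.le
  have := h.half_le
  have : 0 ≤ η / x := div_nonneg (by linarith) (by linarith)
  unfold devNear
  nlinarith

theorem far_nonneg (h : DevAdmissible p x η) : 0 ≤ devFar p x η := by
  linarith [h.one_sub_le_far, h.le_one]

theorem near_nonneg (h : DevAdmissible p x η) : 0 ≤ devNear p x η := by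
  linarith [h.one_sub_le_near, h.le_one]

theorem play_at (h : DevAdmissible p x η) {θ : unitInterval} (hθ : (θ : ℝ) = x) :
    (devPlay x η θ State.low : ℝ) = (x - η) / x ∧
      (devPlay x η θ State.high : ℝ) = (1 - 2 * x + η) / (1 - x) := by
  obtain ⟨-, -, h1, h2, h3, -, -⟩ := h
  simp only [devPlay, if_pos hθ]
  refine ⟨coe_toUnit (div_nonneg (by linarith) (by linarith))
    ((div_le_one (by linarith)).2 (by linarith)), coe_toUnit
    (div_nonneg (by linarith) (by linarith)) ((div_le_one (by linarith)).2 (by linarith))⟩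

theorem play_at_symm (h : DevAdmissible p x η) {θ : unitInterval} (hθ : (θ : ℝ) = 1 - x) :
    (devPlay x η θ State.low : ℝ) = (x - η) / (1 - x) ∧
      (devPlay x η θ State.high : ℝ) = η / x := by
  obtain ⟨-, -, h1, h2, h3, -, -⟩ := h
  have hne : ¬ (θ : ℝ) = x := by rw [hθ]; intro hh; linarith
  simp only [devPlay, if_neg hne, if_pos hθ]
  refine ⟨coe_toUnit (div_nonneg (by linarith) (by linarith))
    ((div_le_one (by linarith)).2 (by linarith)), coe_toUnit
    (div_nonneg (by linarith) (by linarith)) ((div_le_one (by linarith)).2 (by linarith))⟩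

theorem update_at (h : DevAdmissible p x η) {θ : unitInterval} (hθ : (θ : ℝ) = x) :
    (devUpdate p x η θ Move1.T : ℝ) = 1 - devFar p x η ∧
      (devUpdate p x η θ Move1.B : ℝ) = devNear p x η := by
  have := h.far_nonneg
  have := h.near_nonneg
  have := h.far_le
  have := h.near_le
  simp only [devUpdate, if_pos hθ]
  exact ⟨coe_toUnit (by linarith) (by linarith), coe_toUnit (by linarith) (by linarith)⟩

theorem update_at_symm (h : DevAdmissible p x η) {θ : unitInterval} (hθ : (θ : ℝ) = 1 - x) :
    (devUpdate p x η θ Move1.T : ℝ) = 1 - devNear p x η ∧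
      (devUpdate p x η θ Move1.B : ℝ) = devFar p x η := by
  have := h.far_nonneg
  have := h.near_nonneg
  have := h.far_le
  have := h.near_le
  have hne : ¬ (θ : ℝ) = x := by rw [hθ]; intro hh; linarith [h.lt_half]
  simp only [devUpdate, if_neg hne, if_pos hθ]
  exact ⟨coe_toUnit (by linarith) (by linarith), coe_toUnit (by linarith) (by linarith)⟩

theorem play_other {θ : unitInterval} (h1 : (θ : ℝ) ≠ x) (h2 : (θ : ℝ) ≠ 1 - x) :
    devPlay x η θ = starPlay θ := by
  funext s
  simp only [devPlay, if_neg h1, if_neg h2]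

theorem update_other {θ : unitInterval} (h1 : (θ : ℝ) ≠ x) (h2 : (θ : ℝ) ≠ 1 - x) :
    devUpdate p x η θ = starUpdate p θ := by
  funext s
  simp only [devUpdate, if_neg h1, if_neg h2]

theorem moveProbAt_at (h : DevAdmissible p x η) {θ : unitInterval}
    (hθ : (θ : ℝ) = x ∨ (θ : ℝ) = 1 - x) :
    moveProbAt (devPlay x η) θ Move1.T = 1 - θ ∧ moveProbAt (devPlay x η) θ Move1.B = θ := by
  have hx : x ≠ 0 := by linarith [h.pos, h.le]
  have hx1 : 1 - x ≠ 0 := by linarith [h.lt_half]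
  simp only [moveProbAt, moveProb1]
  rcases hθ with hθ | hθ
  · rw [(h.play_at hθ).1, (h.play_at hθ).2, hθ]
    constructor <;> field_simp <;> ring
  · rw [(h.play_at_symm hθ).1, (h.play_at_symm hθ).2, hθ]
    constructor <;> field_simp <;> ring

theorem isBayes (h : DevAdmissible p x η) : IsBayes p (devPlay x η) (devUpdate p x η) := by
  have hx : x ≠ 0 := by linarith [h.pos, h.le]
  have hx1 : 1 - x ≠ 0 := by linarith [h.lt_half]
  intro θ a
  by_cases h1 : (θ : ℝ) = x
  · cases a
    · rw [(h.moveProbAt_at (Or.inl h1)).1, (h.update_at h1).1]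
      simp only [moveProb1]
      rw [(h.play_at h1).1, (h.play_at h1).2, h1, devFar]
      field_simp
      ring
    · rw [(h.moveProbAt_at (Or.inl h1)).2, (h.update_at h1).2]
      simp only [moveProb1]
      rw [(h.play_at h1).1, (h.play_at h1).2, h1, devNear]
      field_simp
      ring
  by_cases h2 : (θ : ℝ) = 1 - x
  · cases a
    · rw [(h.moveProbAt_at (Or.inr h2)).1, (h.update_at_symm h2).1]
      simp only [moveProb1]
      rw [(h.play_at_symm h2).1, (h.play_at_symm h2).2, h2, devNear]
      field_simp
      ring
    · rw [(h.moveProbAt_at (Or.inr h2)).2, (h.update_at_symm h2).2]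
      simp only [moveProb1]
      rw [(h.play_at_symm h2).1, (h.play_at_symm h2).2, h2, devFar]
      field_simp
      ring
  · have := isBayes_star p θ a
    unfold moveProbAt at this ⊢
    rw [play_other h1 h2, update_other h1 h2]
    exact this

theorem gain_low (h : DevAdmissible p x η) (θ : unitInterval) :
    (θ : ℝ) * devPlay x η θ State.low = devGain x η θ := by
  have hx : x ≠ 0 := by linarith [h.pos, h.le]
  have hx1 : 1 - x ≠ 0 := by linarith [h.lt_half]
  unfold devGain
  by_cases h1 : (θ : ℝ) = x
  · rw [if_pos (Or.inl h1), (h.play_at h1).1, h1]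
    field_simp
  by_cases h2 : (θ : ℝ) = 1 - x
  · rw [if_pos (Or.inr h2), (h.play_at_symm h2).1, h2]
    field_simp
  · rw [if_neg (by tauto), play_other h1 h2, starPlay_low]

theorem gain_high (h : DevAdmissible p x η) (θ : unitInterval) :
    (1 - (θ : ℝ)) * (1 - devPlay x η θ State.high) = devGain x η θ := by
  have hx : x ≠ 0 := by linarith [h.pos, h.le]
  have hx1 : 1 - x ≠ 0 := by linarith [h.lt_half]
  unfold devGain
  by_cases h1 : (θ : ℝ) = x
  · rw [if_pos (Or.inl h1), (h.play_at h1).2, h1]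
    field_simp
    ring
  by_cases h2 : (θ : ℝ) = 1 - x
  · rw [if_pos (Or.inr h2), (h.play_at_symm h2).2, h2]
    field_simp
    ring
  · rw [if_neg (by tauto), play_other h1 h2, starPlay_high]

/-- The modification keeps the probabilities of the two moves; it lowers the stage gain by η and
changes only the two posterior beliefs. -/
theorem drift_at (h : DevAdmissible p x η) (H : ℝ → ℝ) {θ : unitInterval}
    (hθ : foldBelief θ = x) :
    drift (devPlay x η) (devUpdate p x η) (devGain x η) (fun θ => H (foldBelief θ)) θ =
      x - η + (1 - x) * H (devFar p x η) + x * H (devNear p x η) - H x := by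
  have hf : foldBelief (devFar p x η) = devFar p x η := min_eq_left (by linarith [h.far_le])
  have hn : foldBelief (devNear p x η) = devNear p x η := min_eq_left (by linarith [h.near_le])
  have hor : (θ : ℝ) = x ∨ (θ : ℝ) = 1 - x := by
    unfold foldBelief at hθ
    rcases le_total (θ : ℝ) (1 - θ) with h1 | h1
    · left; rwa [min_eq_left h1] at hθ
    · right; rw [min_eq_right h1] at hθ; linarith
  simp only [drift, devGain, if_pos hor, hθ, (h.moveProbAt_at hor).1, (h.moveProbAt_at hor).2]
  rcases hor with h1 | h1
  · rw [(h.update_at h1).1, (h.update_at h1).2, foldBelief_symm, hf, hn, h1]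
  · rw [(h.update_at_symm h1).1, (h.update_at_symm h1).2, foldBelief_symm, hf, hn, h1]
    ring

theorem drift_other (h : DevAdmissible p x η) (H : ℝ → ℝ) {θ : unitInterval}
    (hθ : foldBelief θ ≠ x) :
    drift (devPlay x η) (devUpdate p x η) (devGain x η) (fun θ => H (foldBelief θ)) θ =
      foldBelief θ + (1 - foldBelief θ) * H (foldMap p (foldBelief θ)) +
        foldBelief θ * H (1 - p) - H (foldBelief θ) := by
  have h1 : (θ : ℝ) ≠ x := by
    intro e
    apply hθ
    rw [e]
    exact min_eq_left (by linarith [h.lt_half])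
  have h2 : (θ : ℝ) ≠ 1 - x := by
    intro e
    apply hθ
    rw [e, foldBelief_symm]
    exact min_eq_left (by linarith [h.lt_half])
  rw [← drift_star h.half_le]
  simp only [drift, moveProbAt, devGain, play_other h1 h2, update_other h1 h2]
  rw [if_neg (by tauto)]

end DevAdmissible

/-! ### Strict improvement on σ*. -/

open Classical in
/-- A bounded function that triples along the orbits of `F` until they reach the point `y`. -/
theorem exists_tripling (F : ℝ → ℝ) (N : ℕ) (x₀ : ℝ) :
    ∃ (r : ℝ) (β : ℝ → ℝ), 0 < r ∧ r ≤ 1 ∧ (∀ x, 0 ≤ β x ∧ β x ≤ 1) ∧ r ≤ β x₀ ∧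
      ∀ x, x ≠ F^[N] x₀ → 3 * β x ≤ β (F x) := by
  set y := F^[N] x₀ with hy
  set β : ℝ → ℝ := fun x => if h : ∃ j, F^[j] x = y then (1 / 3 : ℝ) ^ Nat.find h else 0 with hβ
  have hβ0 : ∀ x, 0 ≤ β x ∧ β x ≤ 1 := by
    intro x
    simp only [hβ]
    split_ifs
    · exact ⟨by positivity, pow_le_one₀ (by norm_num) (by norm_num)⟩
    · exact ⟨le_rfl, zero_le_one⟩
  have hβ1 : ∀ x j, F^[j] x = y → (1 / 3 : ℝ) ^ j ≤ β x := by
    intro x j hj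
    have h : ∃ j, F^[j] x = y := ⟨j, hj⟩
    simp only [hβ, dif_pos h]
    exact pow_le_pow_of_le_one (by norm_num) (by norm_num) (Nat.find_min' h hj)
  refine ⟨(1 / 3) ^ N, β, by positivity, pow_le_one₀ (by norm_num) (by norm_num), hβ0,
    hβ1 x₀ N rfl, fun x hx => ?_⟩
  by_cases h : ∃ j, F^[j] x = y
  · have e : β x = (1 / 3 : ℝ) ^ Nat.find h := by simp only [hβ, dif_pos h]
    have hspec := Nat.find_spec h
    rcases hj : Nat.find h with _ | j
    · rw [hj] at hspec
      exact absurd hspec hx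
    · rw [hj, Function.iterate_succ_apply] at hspec
      have := hβ1 (F x) j hspec
      rw [e, hj, pow_succ]
      linarith
  · have e : β x = 0 := by simp only [hβ, dif_neg h]
    rw [e, mul_zero]
    exact (hβ0 _).1

/-- For x > 1/3 the non-revealing move reverses the orientation, and this is why revealing less
moves the folded belief to the right. -/
theorem devFar_eq {p x η : ℝ} (hp : 1 / 2 ≤ p) (h : 1 / 3 < x) (h1 : x < 1 / 2) :
    devFar p x η = foldMap p x + (2 * p - 1) / (1 - x) * η := by
  have : 1 - x ≠ 0 := by linarith
  rw [foldMap_of_ge hp h.le (by linarith), devFar]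
  field_simp
  ring

theorem tendsto_mul_nhdsGT {a : ℝ} (ha : 0 < a) :
    Tendsto (fun η : ℝ => a * η) (nhdsWithin 0 (Set.Ioi 0)) (nhdsWithin 0 (Set.Ioi 0)) := by
  refine tendsto_nhdsWithin_iff.2 ⟨(Continuous.tendsto' (by fun_prop) 0 0 (by simp)).mono_left
    nhdsWithin_le_nhds, ?_⟩
  filter_upwards [self_mem_nhdsWithin] with δ hδ
  exact mul_pos ha hδ

/-- If the expected reveal time is steep at `1 - p` and at the point that follows the `N`-th point
of the orbit, then revealing less at the `N`-th point improves on `σ*`. -/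
theorem exists_improvement {p : unitInterval} (hp : 1 / 2 < (p : ℝ)) (hp1 : (p : ℝ) < 1)
    {ℓ : ℝ → ℝ} (hℓ : IsRevealTime p ℓ) {v K K' : ℝ} (hv0 : 0 < v) (hv : v * ℓ (1 - p) = 1) (N : ℕ)
    (hx3 : 1 / 3 < orbit p N) (hx2 : orbit p N < 1 / 2)
    (hK : HasRightDecrease ℓ (1 - p) K) (hK' : HasRightDecrease ℓ (foldMap p (orbit p N)) K')
    (hlt : ℓ (1 - p) < (2 * p - 1) * (K + K')) (θ₀ : unitInterval) :
    ∃ (σ : Strategy1) (v' : ℝ), v < v' ∧ Guarantees1 p θ₀ σ v' := by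
  set x := orbit p N with hx
  have hc : 0 < 2 * (p : ℝ) - 1 := by linarith
  have hxq : 1 - (p : ℝ) ≤ x := (orbit_mem hp.le hp1.le N).1
  have hF : foldMap p x < 1 / 2 := by
    rw [foldMap_of_ge hp.le hx3.le (by linarith)]
    have : 1 / 2 < x / (1 - x) := by rw [lt_div_iff₀ (by linarith)]; linarith
    nlinarith
  have hFq : 1 - (p : ℝ) ≤ foldMap p x := (foldMap_mem hp.le (by linarith) hx2.le).1
  have a1 : 0 < (2 * (p : ℝ) - 1) / (1 - x) := div_pos hc (by linarith)
  have a0 : 0 < (2 * (p : ℝ) - 1) / x := div_pos hc (by linarith)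
  have near_eq : ∀ η, devNear p x η = 1 - p + (2 * p - 1) / x * η := fun η => by
    unfold devNear; ring
  have t1 := tendsto_mul_nhdsGT a1
  have t0 := tendsto_mul_nhdsGT a0
  have ev : ∀ᶠ η in nhdsWithin (0 : ℝ) (Set.Ioi 0), DevAdmissible p x η ∧
      (2 * p - 1) / (1 - x) * η * K' ≤ ℓ (foldMap p x) - ℓ (devFar p x η) ∧
      (2 * p - 1) / x * η * K ≤ ℓ (1 - p) - ℓ (devNear p x η) := by
    have l1 := eventually_lt_of_linear (a := -((2 * (p : ℝ) - 1) / (1 - x))) (b := 0) hF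
    have l0 := eventually_lt_of_linear (a := -((2 * (p : ℝ) - 1) / x)) (b := 0)
      (show 1 - (p : ℝ) < 1 / 2 by linarith)
    have l2 := eventually_lt_of_linear (a := -1) (b := 0) (show (0 : ℝ) < x by linarith)
    filter_upwards [t1.eventually hK', t0.eventually hK, l1, l0, l2, self_mem_nhdsWithin]
      with η b1 b0 m1 m0 m2 hη
    have hη : 0 < η := hη
    refine ⟨⟨hp.le, hp1.le, hη, by linarith, hx2, ?_, ?_⟩, ?_, ?_⟩
    · rw [devFar_eq hp.le hx3 hx2]; linarith
    · rw [near_eq]; linarith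
    · rw [devFar_eq hp.le hx3 hx2]; exact b1
    · rw [near_eq]; exact b0
  obtain ⟨η, hadm, g1, g0⟩ := ev.exists
  -- The net gain of the deviation at x: the probabilities 1 - x and x cancel the denominators of
  -- the two belief shifts, leaving η v (2p - 1)(K + K') against the loss η.
  set κ : ℝ := η * (v * ((2 * p - 1) * (K + K')) - 1) with hκ
  have hκ0 : 0 < κ := by
    refine mul_pos hadm.pos ?_
    have := mul_lt_mul_of_pos_left hlt hv0
    linarith
  obtain ⟨r, β, hr0, hr1, hβ, hβr, hβ3⟩ := exists_tripling (foldMap p) N (1 - p)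
  -- The gain κ occurs only at x. The correction B, weighted by κ / 2, spreads it over all beliefs;
  -- the value -1 below 1 - p yields a bonus on entering the invariant interval.
  set B : ℝ → ℝ := fun z => if 1 - (p : ℝ) ≤ z then β z else -1 with hB
  have hBβ : ∀ z, 1 - (p : ℝ) ≤ z → B z = β z := fun z hz => if_pos hz
  have hB1 : ∀ z, |B z| ≤ 1 := by
    intro z
    simp only [hB]
    split_ifs
    · rw [abs_of_nonneg (hβ z).1]; exact (hβ z).2
    · simp
  obtain ⟨C, hC⟩ := extendTime_bounded hp.le hℓ
  set H : ℝ → ℝ := fun z => (1 - v * extendTime p ℓ z) + κ / 2 * B z with hH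
  have hHb : ∀ θ : unitInterval, |H (foldBelief θ)| ≤ 1 + v * C + κ / 2 := by
    intro θ
    simp only [hH]
    have h1 := abs_le.1 (hC _ (foldBelief_mem θ))
    have h2 := abs_le.1 (hB1 (foldBelief θ))
    rw [abs_le]
    constructor <;> nlinarith
  have hq1 : 0 < 1 - (p : ℝ) := by linarith
  have hqr : (1 - (p : ℝ)) * r ≤ 1 := by nlinarith
  have hext : ∀ z, 1 - (p : ℝ) ≤ z → extendTime p ℓ z = ℓ z := fun z hz => if_pos hz
  refine ⟨beliefStrategy (devPlay x η) (devUpdate p x η) θ₀, v + κ / 2 * ((1 - p) * r),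
    by linarith [mul_pos (half_pos hκ0) (mul_pos hq1 hr0)], fun τ => ?_⟩
  refine le_liminf_avgGain p θ₀ _ τ fun n => totalGain_ge_of_drift hadm.isBayes hadm.gain_low
    hadm.gain_high (H := fun θ => H (foldBelief θ)) hHb (fun θ => ?_) θ₀ τ n
  by_cases hθ : foldBelief θ = x
  · rw [hadm.drift_at H hθ]
    have hB2 : ∀ z, 1 - (p : ℝ) ≤ z → 0 ≤ B z := fun z hz => by rw [hBβ z hz]; exact (hβ z).1
    have e1 := mul_nonneg (half_pos hκ0).le (mul_nonneg (show 0 ≤ 1 - x by linarith)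
      (hB2 _ hadm.one_sub_le_far))
    have e2 := mul_nonneg (half_pos hκ0).le (mul_nonneg (show 0 ≤ x by linarith)
      (hB2 _ hadm.one_sub_le_near))
    have e3 : κ / 2 * B x ≤ κ / 2 := by
      have := (abs_le.1 (hB1 x)).2
      nlinarith
    have e4 : κ / 2 * ((1 - p) * r) ≤ κ / 2 := by nlinarith
    simp only [hH, hext _ hadm.one_sub_le_far, hext _ hadm.one_sub_le_near, hext _ hxq,
      hℓ.1 x ⟨hxq, hx2.le⟩]
    have f1 := mul_le_mul_of_nonneg_left g1 (mul_nonneg hv0.le (show 0 ≤ 1 - x by linarith))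
    have f0 := mul_le_mul_of_nonneg_left g0 (mul_nonneg hv0.le (show 0 ≤ x by linarith))
    have f1' : v * (1 - x) * ((2 * p - 1) / (1 - x) * η * K') = η * (v * ((2 * p - 1) * K')) := by
      have : 1 - x ≠ 0 := by linarith
      field_simp
    have f0' : v * x * ((2 * p - 1) / x * η * K) = η * (v * ((2 * p - 1) * K)) := by
      have : x ≠ 0 := by linarith
      field_simp
    rw [f1'] at f1
    rw [f0'] at f0
    have hκ' : κ = η * (v * ((2 * p - 1) * K)) + η * (v * ((2 * p - 1) * K')) - η := by
      rw [hκ]; ring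
    have hvx : x * (v * ℓ (1 - p)) = x := by rw [hv, mul_one]
    linarith
  · rw [hadm.drift_other H hθ]
    obtain ⟨z0, z2⟩ := foldBelief_mem θ
    set z := foldBelief θ with hz
    have hFz := (foldMap_mem hp.le z0 z2).1
    have h1 := extendTime_eq hp.le hℓ z0 z2
    have hq : extendTime p ℓ (1 - p) = ℓ (1 - p) := hext _ le_rfl
    -- Away from x, tripling gives (1 - z) β(F z) ≥ 3(1 - z) β(z) ≥ β(z) since z ≤ 1/2, and a
    -- revelation, of probability z ≥ 1 - p, adds at least (1 - p) r.
    have hbonus : (1 - p) * r ≤ (1 - z) * B (foldMap p z) + z * B (1 - p) - B z := by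
      rw [hBβ _ hFz, hBβ _ le_rfl]
      have c1 := mul_nonneg (show 0 ≤ 1 - z by linarith) (hβ (foldMap p z)).1
      by_cases hzq : 1 - (p : ℝ) ≤ z
      · rw [hBβ _ hzq]
        have c3 := mul_le_mul_of_nonneg_left (hβ3 z hθ) (show 0 ≤ 1 - z by linarith)
        have c4 := mul_le_mul_of_nonneg_left hβr z0
        have c5 := mul_le_mul_of_nonneg_right hzq hr0.le
        have c6 := mul_nonneg (show 0 ≤ 2 - 3 * z by linarith) (hβ z).1
        linarith
      · have : B z = -1 := if_neg hzq
        rw [this]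
        have c2 := mul_nonneg z0 (hβ (1 - p)).1
        linarith
    have hb2 := mul_le_mul_of_nonneg_left hbonus (half_pos hκ0).le
    simp only [hH]
    rw [h1, hq]
    have hvz : z * (v * ℓ (1 - p)) = z := by rw [hv, mul_one]
    linarith

/-! ### Conclusions at the two parameters. -/

theorem not_isOptimal_badParam {p : unitInterval} (hpb : (p : ℝ) = badParam) (θ₀ : unitInterval) :
    ¬ IsOptimal p θ₀ (sigmaStar p θ₀) ∧
      ∃ (σ : Strategy1) (v : ℝ), Guarantees1 p θ₀ σ v ∧
        ¬ Guarantees1 p θ₀ (sigmaStar p θ₀) v := by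
  obtain ⟨ℓ, K, K', hℓ, hpos, hK, hK', hlt, hx3, hx2⟩ := exists_steep_revealTime
  rw [← hpb] at hℓ hpos hK hK' hlt hx3 hx2
  have hp : 1 / 2 < (p : ℝ) := by rw [hpb]; norm_num [badParam]
  have hv : 1 / ℓ (1 - p) * ℓ (1 - p) = 1 := div_mul_cancel₀ _ hpos.ne'
  obtain ⟨σ, v', hvv, hσ⟩ := exists_improvement hp (hpb ▸ badParam_lt_one) hℓ (by positivity) hv 57
    hx3 hx2 hK hK' hlt θ₀
  refine ⟨?_, σ, v', hσ, fun h => (le_of_guarantees1_star hp.le hℓ hv h).not_gt hvv⟩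
  -- No value has to be known to exist: a strategy τ witnessing any candidate value v forces v' ≤ v,
  -- while σ* guarantees nothing above 1 / ℓ(1 - p) < v'.
  rintro ⟨v, ⟨-, τ, hτ⟩, hs⟩
  have h1 : v' ≤ v := (hσ τ).trans ((liminf_le_limsup_avgGain p θ₀ σ τ).trans (hτ σ))
  exact ((h1.trans (le_of_guarantees1_star hp.le hℓ hv hs))).not_gt hvv

theorem sigmaStarOptimal_of_le {p : unitInterval} (hp : 1 / 2 ≤ (p : ℝ)) (hp' : (p : ℝ) ≤ 0.7191) :
    SigmaStarOptimal p := by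
  rcases le_or_gt (p : ℝ) (2 / 3) with h | h
  · exact sigmaStarOptimal_of_le_two_thirds hp h
  · exact sigmaStarOptimal_of_two_thirds_lt h hp'

end RenaultGame

theorem theorem1 :
    (∀ p : unitInterval, 1 / 2 ≤ (p : ℝ) → (p : ℝ) < 0.719 →
      RenaultGame.SigmaStarOptimal p) ∧
    (∃ p : unitInterval, (p : ℝ) = 0.73275300915 ∧
      ∀ θ₀ : unitInterval,
        ¬ RenaultGame.IsOptimal p θ₀ (RenaultGame.sigmaStar p θ₀) ∧
        ∃ (σ : RenaultGame.Strategy1) (v : ℝ),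
          RenaultGame.Guarantees1 p θ₀ σ v ∧
          ¬ RenaultGame.Guarantees1 p θ₀ (RenaultGame.sigmaStar p θ₀) v) ∧
    0.719 < RenaultGame.criticalParameter ∧
    RenaultGame.criticalParameter < 0.733 := by
  have hbad : (RenaultGame.badParam) ∈ unitInterval := by
    constructor <;> norm_num [RenaultGame.badParam]
  have upper : ∀ q ∈ {q : ℝ | 1 / 2 ≤ q ∧ q ≤ 1 ∧ ∀ p : unitInterval, 1 / 2 ≤ (p : ℝ) →
      (p : ℝ) ≤ q → RenaultGame.SigmaStarOptimal p}, q ≤ RenaultGame.badParam := by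
    rintro q ⟨-, -, hq⟩
    by_contra hlt
    push Not at hlt
    exact (RenaultGame.not_isOptimal_badParam (p := ⟨_, hbad⟩) rfl 0).1
      (hq ⟨_, hbad⟩ RenaultGame.half_le_badParam hlt.le 0)
  -- Optimality was proved up to 0.7191, beyond 0.719, to make the lower bound on the supremum
  -- strict.
  have lower : (0.7191 : ℝ) ∈ {q : ℝ | 1 / 2 ≤ q ∧ q ≤ 1 ∧ ∀ p : unitInterval, 1 / 2 ≤ (p : ℝ) →
      (p : ℝ) ≤ q → RenaultGame.SigmaStarOptimal p} :=
    ⟨by norm_num, by norm_num, fun p h1 h2 => RenaultGame.sigmaStarOptimal_of_le h1 h2⟩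
  refine ⟨fun p h1 h2 => RenaultGame.sigmaStarOptimal_of_le h1 (by norm_num at h2 ⊢; linarith),
    ⟨⟨_, hbad⟩, rfl, fun θ₀ => RenaultGame.not_isOptimal_badParam rfl θ₀⟩, ?_, ?_⟩
  · exact lt_of_lt_of_le (by norm_num) (le_csSup ⟨_, upper⟩ lower)
  · exact lt_of_le_of_lt (csSup_le ⟨_, lower⟩ upper) (by norm_num [RenaultGame.badParam])
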